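/- Let $\Sigma=\Gamma\backslash\mathbb H^2$ be a complete oriented hyperbolic surface, where $\Gamma$ is a discrete group of orientation-preserving isometries of the hyperbolic plane $\mathbb H^2$ acting freely (for example, any complete hyperbolic surface of finite area). The punctures of $\Sigma$ correspond to the $\Gamma$-orbits of cusps, i.e. of fixed points at infinity of parabolic elements of $\Gamma$. Fix a decoration of $\Sigma$, i.e. a $\Gamma$-equivariant choice of a horocycle at each cusp. An arc in $\Sigma$ is an open curve both of whose ends converge to punctures; homotopies of arcs keep the ends at the punctures and everything else in $\Sigma$. The length of a geodesic arc is the signed length of the segment of a lift to $\mathbb H^2$ between the two chosen horocycles at its ends (positive if the horoballs they bound are disjoint, negative if they overlap). The length of a loop is that of the closed geodesic freely homotopic to it, and is $0$ if the loop goes around a puncture, i.e. is not null-homotopic but can be homotoped into every neighbourhood of some puncture. The curling number $c(\beta)$ of an arc $\beta$ is the maximal number of successive removals of curls that $\beta$ carries, where a curl is a null-homotopic loop formed by the part of the arc between two passages through the same point (its vertex). Let $\alpha$ be a geodesic arc of length $a$ in $\Sigma$, and let $p=\alpha(s)=\alpha(t)$, $s<t$, be one of its self-intersections. The separating resolution of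 $\alpha$ at $p$ consists of the loop $\alpha|_{[s,t]}$ (the loop component) and of the arc obtained from $\alpha$ by removing this loop (the arc component); the non-separating resolution $\beta$ is the arc obtained from $\alpha$ by traversing the loop $\alpha|_{[s,t]}$ backwards. Let $x$ and $y$ be the lengths of the loop component and of the geodesic representative of the arc component, and suppose that $\beta$ is homotopic to a geodesic arc, of length $z$. 1. If $c(\beta)=0$, then $$e^{a/2}=2\cosh\frac{x}{2}\,e^{y/2}+e^{z/2}.$$ 2. If $c(\beta)=1$, then $$e^{a/2}=2\cosh\frac{x}{2}\,e^{y/2}-e^{z/2}.$$ In particular, the formulae hold, with $x=0$, when the loop component goes around a puncture. -/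

import Mathlib

open scoped UpperHalfPlane MatrixGroups unitInterval

namespace HyperbolicArc

/-! ### Hyperbolic surfaces, cusps and decorations

A complete oriented hyperbolic surface is presented as the quotient of the hyperbolic plane `ℍ` by
a discrete subgroup `Γ` of `SL(2, ℝ)` whose image in `PSL(2, ℝ)` acts freely. Its punctures are the
`Γ`-orbits of the cusps of `Γ`, that is, of the fixed points in `ℝ ∪ {∞}` of parabolic elements. -/

/-- The elements of `Γ` other than `±1` have no fixed point in `ℍ`. -/
def ActsFreely (Γ : Subgroup SL(2, ℝ)) : Prop :=
  ∀ γ ∈ Γ, ∀ z : ℍ, γ • z = z → γ = 1 ∨ γ = -1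

/-- The surface `Γ \ ℍ`, with the quotient topology. -/
abbrev Surface (Γ : Subgroup SL(2, ℝ)) : Type :=
  Quotient (MulAction.orbitRel Γ ℍ)

/-- The universal covering `ℍ → Γ \ ℍ`. -/
noncomputable def proj (Γ : Subgroup SL(2, ℝ)) (z : ℍ) : Surface Γ :=
  Quotient.mk _ z

/-- `c` is fixed by a parabolic element of `Γ`; the orbit of `c` is a puncture of `Γ \ ℍ`. -/
def IsCuspOf (Γ : Subgroup SL(2, ℝ)) (c : OnePoint ℝ) : Prop :=
  IsCusp c (Γ.map (Matrix.SpecialLinearGroup.mapGL ℝ))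

/-- The height of `z` seen from the boundary point `c`: it is `Im z` for `c = ∞`, and
`Im (-1 / (z - x))` for `c = x` real. The horocycles centred at `c` are its level sets, and the
horoballs centred at `c` are its superlevel sets. -/
noncomputable def height (c : OnePoint ℝ) (z : ℍ) : ℝ :=
  c.elim z.im (fun x => z.im / Complex.normSq ((z : ℂ) - (x : ℂ)))

/-- The horocycle centred at `c` of level `h`. -/
def horocycle (c : OnePoint ℝ) (h : ℝ) : Set ℍ :=
  {z | height c z = h}

/-- A decoration: a horocycle at each puncture of the surface, that is, a `Γ`-equivariant choice of
a horocycle at each cusp of `Γ`. -/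
structure Decoration (Γ : Subgroup SL(2, ℝ)) where
  /-- the level of the horocycle chosen at a cusp -/
  level : OnePoint ℝ → ℝ
  level_pos : ∀ c, IsCuspOf Γ c → 0 < level c
  equivariant : ∀ γ ∈ Γ, ∀ c, IsCuspOf Γ c → ∀ z ∈ horocycle c (level c),
    γ • z ∈ horocycle (Matrix.SpecialLinearGroup.mapGL ℝ γ • c)
      (level (Matrix.SpecialLinearGroup.mapGL ℝ γ • c))

/-- The filter of (punctured) neighbourhoods on the surface of the puncture given by the cusp `c`:
it is generated by the images of the horoballs centred at `c`. -/
noncomputable def punctureFilter (Γ : Subgroup SL(2, ℝ)) (c : OnePoint ℝ) : Filter (Surface Γ) :=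
  Filter.map (proj Γ) (Filter.comap (height c) Filter.atTop)

/-! ### Homotopies

Loops are maps on the unit interval with equal end values. The open arcs between punctures are
parametrized by `ℝ`. -/

/-- Free homotopy of loops. -/
def FreelyHomotopic {X : Type*} [TopologicalSpace X] (f g : I → X) : Prop :=
  ∃ H : I × I → X, Continuous H ∧ (∀ τ, H (0, τ) = f τ) ∧ (∀ τ, H (1, τ) = g τ) ∧
    ∀ u, H (u, 0) = H (u, 1)

/-- The loop `f` is homotopic to a constant loop. -/
def NullHomotopic {X : Type*} [TopologicalSpace X] (f : I → X) : Prop :=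
  ∃ q : X, FreelyHomotopic f fun _ => q

/-- Homotopy of arcs between punctures: the ends stay at fixed punctures and the rest of the arc
stays in the surface. -/
def ArcHomotopic (Γ : Subgroup SL(2, ℝ)) (f g : ℝ → Surface Γ) : Prop :=
  ∃ (c d : OnePoint ℝ) (H : I × ℝ → Surface Γ), IsCuspOf Γ c ∧ IsCuspOf Γ d ∧ Continuous H ∧
    (∀ t, H (0, t) = f t) ∧ (∀ t, H (1, t) = g t) ∧
    Filter.Tendsto H ((⊤ : Filter I) ×ˢ (Filter.atBot : Filter ℝ)) (punctureFilter Γ c) ∧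
    Filter.Tendsto H ((⊤ : Filter I) ×ˢ (Filter.atTop : Filter ℝ)) (punctureFilter Γ d)

/-! ### Geodesic arcs, closed geodesics and their lengths -/

/-- A geodesic arc between punctures of the surface, given by a lift to `ℍ`: a complete geodesic
parametrized by arc length whose two ends converge to cusps. -/
structure GeodesicArc (Γ : Subgroup SL(2, ℝ)) where
  /-- a lift of the arc to the universal covering -/
  lift : ℝ → ℍ
  isometry_lift : Isometry lift
  /-- the cusp from which the lift comes -/
  source : OnePoint ℝ
  /-- the cusp to which the lift goes -/
  target : OnePoint ℝ
  isCusp_source : IsCuspOf Γ source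
  isCusp_target : IsCuspOf Γ target
  tendsto_source : Filter.Tendsto (fun t => height source (lift t)) Filter.atBot Filter.atTop
  tendsto_target : Filter.Tendsto (fun t => height target (lift t)) Filter.atTop Filter.atTop

/-- The arc on the surface. -/
noncomputable def GeodesicArc.curve {Γ : Subgroup SL(2, ℝ)} (α : GeodesicArc Γ) (t : ℝ) : Surface Γ :=
  proj Γ (α.lift t)

/-- `a` is the length of the geodesic arc `α` for the decoration `D`: the signed length of the
segment of a lift between the horocycles at its two ends. The lift leaves the horoball at its source
at time `t₁` and enters the horoball at its target at time `t₂`, so that the sign is positive if the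
two horoballs are disjoint and negative if they overlap. -/
def GeodesicArc.HasLength {Γ : Subgroup SL(2, ℝ)} (D : Decoration Γ) (α : GeodesicArc Γ) (a : ℝ) :
    Prop :=
  ∃ t₁ t₂ : ℝ, α.lift t₁ ∈ horocycle α.source (D.level α.source) ∧
    α.lift t₂ ∈ horocycle α.target (D.level α.target) ∧ a = t₂ - t₁

/-- `y` is the length of a geodesic representative of the arc `f`. -/
def HasArcLength (Γ : Subgroup SL(2, ℝ)) (D : Decoration Γ) (f : ℝ → Surface Γ) (y : ℝ) : Prop :=
  ∃ β : GeodesicArc Γ, ArcHomotopic Γ f β.curve ∧ β.HasLength D y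

/-- The loop `f` is freely homotopic to a closed geodesic of length `x`. -/
def HasClosedGeodesic (Γ : Subgroup SL(2, ℝ)) (f : I → Surface Γ) (x : ℝ) : Prop :=
  0 < x ∧ ∃ g : ℝ → ℍ, Isometry g ∧ (∀ t, proj Γ (g (t + x)) = proj Γ (g t)) ∧
    FreelyHomotopic f fun τ => proj Γ (g (x * τ))

/-- The loop `f` goes around a puncture: it is not null-homotopic, and it can be homotoped into
every neighbourhood of some puncture. -/
def GoesAroundPuncture (Γ : Subgroup SL(2, ℝ)) (f : I → Surface Γ) : Prop :=
  ¬ NullHomotopic f ∧ ∃ c, IsCuspOf Γ c ∧ ∀ U ∈ punctureFilter Γ c,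
    ∃ f' : I → Surface Γ, (∀ τ, f' τ ∈ U) ∧ FreelyHomotopic f f'

/-- `x` is the length of the geodesic representative of the loop `f`, where the length of a loop
around a puncture is `0`. -/
def HasLoopLength (Γ : Subgroup SL(2, ℝ)) (f : I → Surface Γ) (x : ℝ) : Prop :=
  HasClosedGeodesic Γ f x ∨ (GoesAroundPuncture Γ f ∧ x = 0)

/-! ### Resolutions of a self-intersection `f s = f t`, `s < t`, of an arc `f` -/

/-- The part of `f` from time `s` to time `t`; for `f s = f t`, this is the loop component of the
separating resolution. -/
noncomputable def subloop {X : Type*} (f : ℝ → X) (s t : ℝ) : I → X :=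
  fun τ => f (s + τ * (t - s))

open Classical in
/-- The arc `f` with its part from time `s` to time `t` removed; for `f s = f t`, this is the arc
component of the separating resolution. -/
noncomputable def removeLoop {X : Type*} (f : ℝ → X) (s t : ℝ) : ℝ → X :=
  fun r => if r ≤ s then f r else f (r + (t - s))

open Classical in
/-- The arc `f` with its part from time `s` to time `t` traversed backwards; for `f s = f t`, this
is the non-separating resolution. -/
noncomputable def reverseLoop {X : Type*} (f : ℝ → X) (s t : ℝ) : ℝ → X :=
  fun r => if s ≤ r ∧ r ≤ t then f (s + t - r) else f r

/-! ### The curling number of an arc -/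

/-- The part of the arc `f` from time `s` to time `t` is a curl: a topologically trivial loop. -/
def IsCurl {X : Type*} [TopologicalSpace X] (f : ℝ → X) (s t : ℝ) : Prop :=
  s < t ∧ f s = f t ∧ NullHomotopic (subloop f s t)

/-- The arc `f` carries `n` successive removals of curls (one way Reidemeister moves I). -/
inductive CarriesRemovals {X : Type*} [TopologicalSpace X] : ℕ → (ℝ → X) → Prop
  | zero (f : ℝ → X) : CarriesRemovals 0 f
  | succ (n : ℕ) (f : ℝ → X) (s t : ℝ) (h : IsCurl f s t)
      (hn : CarriesRemovals n (removeLoop f s t)) : CarriesRemovals (n + 1) f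

/-- The curling number of an arc: the maximal number of removals of curls that it carries. -/
noncomputable def curlingNumber {X : Type*} [TopologicalSpace X] (f : ℝ → X) : ℕ∞ :=
  ⨆ n ∈ {n : ℕ | CarriesRemovals n f}, (n : ℕ∞)

end HyperbolicArc

open HyperbolicArc

namespace HyperbolicArc

open Matrix UpperHalfPlane

/-! A decorated cusp is encoded by a vector of the plane, unique up to sign, whose horoball of level
`1` is the chosen one. Then `e ^ (a / 2)` is the absolute value of the determinant of the two end
vectors (`GeodesicArc.HasLength.exp_half`), and the geometry becomes linear algebra in `SL(2, ℝ)`.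

Put the lift of `α` on the vertical geodesic and let `N` be the deck transformation, in these
coordinates, carrying the point of time `t` to that of time `s`. With `L = e ^ (a / 2)`, the arc
component joins the source to the `N`-translate of the target, so `e ^ (y / 2) = L * |N 0 0|`; the
non-separating resolution joins it to the `N * N`-translate, so `e ^ (z / 2) = L * |(N * N) 0 0|`;
and `|tr N| = 2 cosh (x / 2)`. The upper left entry of Cayley-Hamilton, `N² = (tr N) N - 1`, gives
the formula up to the sign of `(N * N) 0 0` (`abs_mul_abs_trace`).

Curls decide that sign. If it is positive, the outer ends of the lifted resolution cross
(`exists_crossing_mul_self`); if it is negative, that lift is injective (`liftReverse_injective`).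
Curls are exactly self-intersections of the lift (`isCurl_proj_iff`).

Reading lengths off lifts requires homotopies to preserve the end cusps. This follows from precisely
invariant horoballs (`IsCuspOf.exists_horoball`), obtained from `shimizu`. -/

/-! ### Boundary points as lines of the plane. -/

/-- The determinant of a pair of vectors of the plane. -/
def det₂ (v w : Fin 2 → ℝ) : ℝ := v 0 * w 1 - v 1 * w 0

lemma det₂_mulVec (g : SL(2, ℝ)) (v w : Fin 2 → ℝ) : det₂ (g.1 *ᵥ v) (g.1 *ᵥ w) = det₂ v w := by
  have h := g.2
  rw [det_fin_two] at h
  simp only [det₂, mulVec, dotProduct, Fin.sum_univ_two]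
  linear_combination (v 0 * w 1 - v 1 * w 0) * h

lemma det₂_smul_left (r : ℝ) (v w : Fin 2 → ℝ) : det₂ (r • v) w = r * det₂ v w := by
  simp only [det₂, Pi.smul_apply, smul_eq_mul]; ring

lemma det₂_smul_right (r : ℝ) (v w : Fin 2 → ℝ) : det₂ v (r • w) = r * det₂ v w := by
  simp only [det₂, Pi.smul_apply, smul_eq_mul]; ring

/-- A vector of the plane spanning the line given by a boundary point of `ℍ`. -/
def boundaryVec (c : OnePoint ℝ) : Fin 2 → ℝ := c.elim ![1, 0] fun x => ![x, 1]

@[simp] lemma boundaryVec_infty : boundaryVec OnePoint.infty = ![1, 0] := rfl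

@[simp] lemma boundaryVec_coe (x : ℝ) : boundaryVec (x : OnePoint ℝ) = ![x, 1] := rfl

lemma boundaryVec_ne_zero (c : OnePoint ℝ) : boundaryVec c ≠ 0 := by
  intro h
  have h0 := congrFun h 0
  have h1 := congrFun h 1
  cases c <;> simp at h0 h1

lemma eq_of_det₂_boundaryVec {c d : OnePoint ℝ} (h : det₂ (boundaryVec c) (boundaryVec d) = 0) :
    c = d := by
  cases c <;> cases d <;> simp [det₂] at h ⊢
  linarith

/-- The boundary of `ℍ` is the projective line, so the Möbius action is the linear action on lines;
the scalar `r` records the normalization of `boundaryVec`. -/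
lemma exists_mulVec_boundaryVec (g : SL(2, ℝ)) (c : OnePoint ℝ) :
    ∃ r : ℝ, r ≠ 0 ∧ g.1 *ᵥ boundaryVec c = r • boundaryVec (SpecialLinearGroup.mapGL ℝ g • c) := by
  have h := g.2
  rw [det_fin_two] at h
  have hij (i j : Fin 2) : (SpecialLinearGroup.mapGL ℝ g) i j = g.1 i j := by simp
  cases c with
  | infty =>
    rw [OnePoint.smul_infty_eq_ite]
    simp only [hij]
    by_cases h1 : g.1 1 0 = 0
    · refine ⟨g.1 0 0, fun h0 => by simp [h0, h1] at h, ?_⟩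
      ext i
      fin_cases i <;> simp [h1, mulVec, dotProduct]
    · refine ⟨g.1 1 0, h1, ?_⟩
      ext i
      fin_cases i <;> simp [h1, mulVec, dotProduct]
      field_simp
  | coe x =>
    rw [OnePoint.smul_some_eq_ite]
    simp only [hij]
    by_cases h1 : g.1 1 0 * x + g.1 1 1 = 0
    · refine ⟨g.1 0 0 * x + g.1 0 1, fun h0 => ?_, ?_⟩
      · have : (1 : ℝ) = 0 := by linear_combination -h + (g.1 0 0) * h1 - g.1 1 0 * h0
        norm_num at this
      · ext i
        fin_cases i <;> simp [h1, mulVec, dotProduct]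
    · refine ⟨g.1 1 0 * x + g.1 1 1, h1, ?_⟩
      ext i
      fin_cases i <;> simp [h1, mulVec, dotProduct]
      rw [mul_div_cancel₀ _ h1]

/-! ### Heights and horoballs. -/

/-- The height of `z` seen from the boundary point given by `v`, scaled so that the horoball of
level `1` gets smaller as `v` gets longer. -/
noncomputable def vecHeight (v : Fin 2 → ℝ) (z : ℍ) : ℝ :=
  z.im / Complex.normSq ((v 0 : ℂ) - v 1 * z)

lemma height_eq_vecHeight (c : OnePoint ℝ) (z : ℍ) : height c z = vecHeight (boundaryVec c) z := by
  cases c with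
  | infty => simp [height, vecHeight]
  | coe x =>
    change z.im / Complex.normSq ((z : ℂ) - (x : ℂ)) = _
    rw [← Complex.normSq_neg]
    simp [vecHeight]

lemma normSq_vec_pos {v : Fin 2 → ℝ} (hv : v ≠ 0) (z : ℍ) :
    0 < Complex.normSq ((v 0 : ℂ) - v 1 * z) := by
  rw [Complex.normSq_pos]
  intro h
  have him := congrArg Complex.im h
  have hre := congrArg Complex.re h
  simp [z.im_ne_zero] at him hre
  apply hv
  ext i
  fin_cases i
  · simpa [him] using hre
  · exact him

lemma vecHeight_pos {v : Fin 2 → ℝ} (hv : v ≠ 0) (z : ℍ) : 0 < vecHeight v z :=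
  div_pos z.im_pos (normSq_vec_pos hv z)

lemma vecHeight_smul_vec (r : ℝ) (v : Fin 2 → ℝ) (z : ℍ) :
    vecHeight (r • v) z = vecHeight v z / r ^ 2 := by
  have : ((r • v) 0 : ℂ) - (r • v) 1 * z = r * ((v 0 : ℂ) - v 1 * z) := by
    simp; ring
  rw [vecHeight, this, Complex.normSq_mul, Complex.normSq_ofReal, vecHeight, div_div, sq, mul_comm]

lemma continuous_vecHeight {v : Fin 2 → ℝ} (hv : v ≠ 0) : Continuous (vecHeight v) := by
  refine UpperHalfPlane.continuous_im.div ?_ fun z => (normSq_vec_pos hv z).ne'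
  exact Complex.continuous_normSq.comp (by fun_prop)

lemma continuous_height (c : OnePoint ℝ) : Continuous (height c) := by
  simpa only [funext (height_eq_vecHeight c)] using continuous_vecHeight (boundaryVec_ne_zero c)

lemma denom_ne_zero' (g : SL(2, ℝ)) (z : ℍ) : (g.1 1 0 : ℂ) * z + g.1 1 1 ≠ 0 :=
  UpperHalfPlane.denom_ne_zero (SpecialLinearGroup.mapGL ℝ g) z

lemma coe_smul_eq (g : SL(2, ℝ)) (z : ℍ) :
    ((g • z : ℍ) : ℂ) = ((g.1 0 0 : ℂ) * z + g.1 0 1) / ((g.1 1 0 : ℂ) * z + g.1 1 1) := by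
  simpa using! coe_specialLinearGroup_apply g z

lemma coe_smul_mul (g : SL(2, ℝ)) (z : ℍ) :
    ((g • z : ℍ) : ℂ) * ((g.1 1 0 : ℂ) * z + g.1 1 1) = (g.1 0 0 : ℂ) * z + g.1 0 1 := by
  rw [coe_smul_eq, div_mul_cancel₀ _ (denom_ne_zero' g z)]

lemma im_smul_mul (g : SL(2, ℝ)) (z : ℍ) :
    (g • z).im * Complex.normSq ((g.1 1 0 : ℂ) * z + g.1 1 1) = z.im := by
  have h := g.2
  rw [det_fin_two] at h
  have hne := Complex.normSq_pos.2 (denom_ne_zero' g z)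
  have e : (g • z).im = ((g • z : ℍ) : ℂ).im := rfl
  rw [e, coe_smul_eq, Complex.div_im, ← sub_div, div_mul_cancel₀ _ hne.ne']
  simp
  linear_combination z.im * h

/-- With `j = c z + d` the denominator of `g` at `z`, determinant one makes `v 0 - v 1 * z` scale by
`1 / j`, while `Im z` scales by `1 / |j| ^ 2`; the factors cancel. -/
lemma vecHeight_mulVec_smul (g : SL(2, ℝ)) (v : Fin 2 → ℝ) (z : ℍ) :
    vecHeight (g.1 *ᵥ v) (g • z) = vecHeight v z := by
  have h : (g.1 0 0 : ℂ) * g.1 1 1 - g.1 0 1 * g.1 1 0 = 1 := by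
    have h := g.2
    rw [det_fin_two] at h
    exact_mod_cast h
  have e : (((g.1 *ᵥ v) 0 : ℝ) : ℂ) - ((g.1 *ᵥ v) 1 : ℝ) * ((g • z : ℍ) : ℂ) =
      ((v 0 : ℂ) - v 1 * z) / ((g.1 1 0 : ℂ) * z + g.1 1 1) := by
    rw [eq_div_iff (denom_ne_zero' g z), sub_mul, mul_assoc, coe_smul_mul]
    simp only [mulVec, dotProduct, Fin.sum_univ_two]
    push_cast
    linear_combination ((v 0 : ℂ) - v 1 * z) * h
  rw [vecHeight, vecHeight, e, Complex.normSq_div, ← im_smul_mul g z]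
  field_simp

/-- Two horoballs with different centres meet only if their levels are small enough. -/
lemma det₂_sq_mul_vecHeight_le {v w : Fin 2 → ℝ} (hv : v ≠ 0) (hw : w ≠ 0) (z : ℍ) :
    det₂ v w ^ 2 * (vecHeight v z * vecHeight w z) ≤ 1 := by
  have h1 := normSq_vec_pos hv z
  have h2 := normSq_vec_pos hw z
  rw [vecHeight, vecHeight, div_mul_div_comm, ← mul_div_assoc, div_le_one (mul_pos h1 h2)]
  simp only [Complex.normSq_apply, det₂]
  simp
  -- For `P = v 0 - v 1 * z` and `Q = w 0 - w 1 * z`, the imaginary part of `P * conj Q` is `det₂ v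
  -- w * Im z`; the square supplied is that of its real part.
  nlinarith [sq_nonneg ((v 0 - v 1 * z.re) * (w 0 - w 1 * z.re) + v 1 * w 1 * z.im ^ 2)]

/-- A path going up to infinity towards a boundary point leaves the horoballs centred at the other
boundary points. -/
lemma eq_of_tendsto_height {ι : Type*} {l : Filter ι} [l.NeBot] {F : ι → ℍ} {c d : OnePoint ℝ}
    {h : ℝ} (hh : 0 < h) (hc : Filter.Tendsto (fun t => height c (F t)) l Filter.atTop)
    (hd : ∀ᶠ t in l, h < height d (F t)) : c = d := by
  by_contra hne
  have hdet : 0 < det₂ (boundaryVec c) (boundaryVec d) ^ 2 := by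
    have : det₂ (boundaryVec c) (boundaryVec d) ≠ 0 := fun h => hne (eq_of_det₂_boundaryVec h)
    positivity
  obtain ⟨t, ht, ht'⟩ := (hd.and (hc.eventually_gt_atTop
    (1 / (det₂ (boundaryVec c) (boundaryVec d) ^ 2 * h)))).exists
  have := det₂_sq_mul_vecHeight_le (boundaryVec_ne_zero c) (boundaryVec_ne_zero d) (F t)
  rw [← height_eq_vecHeight, ← height_eq_vecHeight] at this
  rw [div_lt_iff₀ (by positivity)] at ht'
  have hpos : 0 < height c (F t) := by
    rw [height_eq_vecHeight]; exact vecHeight_pos (boundaryVec_ne_zero c) _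
  nlinarith [mul_pos hdet hpos]

/-- Moving by `g` multiplies the heights by a constant. -/
lemma exists_height_smul (g : SL(2, ℝ)) (c : OnePoint ℝ) : ∃ r : ℝ, 0 < r ∧
    ∀ z : ℍ, height (SpecialLinearGroup.mapGL ℝ g • c) (g • z) = r * height c z := by
  obtain ⟨r, hr, h⟩ := exists_mulVec_boundaryVec g c
  refine ⟨r ^ 2, by positivity, fun z => ?_⟩
  have := vecHeight_mulVec_smul g (boundaryVec c) z
  rw [h, vecHeight_smul_vec, div_eq_iff (by positivity)] at this
  rw [height_eq_vecHeight, height_eq_vecHeight, this, mul_comm]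

lemma tendsto_height_smul {ι : Type*} {l : Filter ι} {F : ι → ℍ} {c : OnePoint ℝ} (g : SL(2, ℝ))
    (hc : Filter.Tendsto (fun t => height c (F t)) l Filter.atTop) :
    Filter.Tendsto (fun t => height (SpecialLinearGroup.mapGL ℝ g • c) (g • F t)) l
      Filter.atTop := by
  obtain ⟨r, hr, h⟩ := exists_height_smul g c
  simpa only [h] using hc.const_mul_atTop hr

/-! ### Decorations as vectors up to sign. -/

variable {Γ : Subgroup SL(2, ℝ)}

lemma IsCuspOf.smul {c : OnePoint ℝ} (hc : IsCuspOf Γ c) {γ : SL(2, ℝ)} (hγ : γ ∈ Γ) :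
    IsCuspOf Γ (SpecialLinearGroup.mapGL ℝ γ • c) :=
  IsCusp.smul_of_mem hc (Subgroup.mem_map_of_mem _ hγ)

/-- The vector at a boundary point whose horocycle of level `1` is the chosen one. -/
noncomputable def Decoration.vec (D : Decoration Γ) (c : OnePoint ℝ) : Fin 2 → ℝ :=
  √(D.level c) • boundaryVec c

lemma Decoration.vec_ne_zero (D : Decoration Γ) {c : OnePoint ℝ} (hc : IsCuspOf Γ c) :
    D.vec c ≠ 0 :=
  smul_ne_zero (Real.sqrt_ne_zero'.2 (D.level_pos c hc)) (boundaryVec_ne_zero c)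

lemma Decoration.vecHeight_vec (D : Decoration Γ) {c : OnePoint ℝ} (hc : IsCuspOf Γ c) (z : ℍ) :
    vecHeight (D.vec c) z = height c z / D.level c := by
  rw [Decoration.vec, vecHeight_smul_vec, Real.sq_sqrt (D.level_pos c hc).le, height_eq_vecHeight]

lemma Decoration.mem_horocycle_iff (D : Decoration Γ) {c : OnePoint ℝ} (hc : IsCuspOf Γ c)
    (z : ℍ) : z ∈ horocycle c (D.level c) ↔ vecHeight (D.vec c) z = 1 := by
  rw [D.vecHeight_vec hc, div_eq_one_iff_eq (D.level_pos c hc).ne']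
  rfl

lemma horocycle_nonempty (c : OnePoint ℝ) {h : ℝ} (hh : 0 < h) : (horocycle c h).Nonempty := by
  cases c with
  | infty => exact ⟨⟨⟨0, h⟩, hh⟩, rfl⟩
  | coe x =>
    refine ⟨⟨⟨x, 1 / h⟩, by simpa using hh⟩, ?_⟩
    change (1 / h) / Complex.normSq _ = h
    rw [Complex.normSq_apply]
    simp

/-- Equivariance of the horocycles forces the scalar to have square `1`, by comparing heights at one
point of the chosen horocycle. The sign remains, since a horocycle does not distinguish `v` from
`-v`. -/
lemma Decoration.exists_mulVec_vec (D : Decoration Γ) {c : OnePoint ℝ} (hc : IsCuspOf Γ c)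
    {γ : SL(2, ℝ)} (hγ : γ ∈ Γ) : ∃ e : ℝ, |e| = 1 ∧
      γ.1 *ᵥ D.vec c = e • D.vec (SpecialLinearGroup.mapGL ℝ γ • c) := by
  obtain ⟨r, hr, h⟩ := exists_mulVec_boundaryVec γ c
  have hc' := hc.smul hγ
  have h0 := Real.sqrt_ne_zero'.2 (D.level_pos c hc)
  have h1 := Real.sqrt_ne_zero'.2 (D.level_pos _ hc')
  set e := √(D.level c) * r / √(D.level (SpecialLinearGroup.mapGL ℝ γ • c))
  have he : γ.1 *ᵥ D.vec c = e • D.vec (SpecialLinearGroup.mapGL ℝ γ • c) := by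
    rw [Decoration.vec, mulVec_smul, h, Decoration.vec, smul_smul, smul_smul,
      div_mul_cancel₀ _ h1]
  refine ⟨e, ?_, he⟩
  obtain ⟨z, hz⟩ := horocycle_nonempty c (D.level_pos c hc)
  have hz' := D.equivariant γ hγ c hc z hz
  rw [D.mem_horocycle_iff hc] at hz
  rw [D.mem_horocycle_iff hc'] at hz'
  have := vecHeight_mulVec_smul γ (D.vec c) z
  rw [he, vecHeight_smul_vec, hz, hz'] at this
  have he2 : e ^ 2 = 1 := by
    rwa [one_div, inv_eq_one] at this
  exact (pow_eq_one_iff_of_nonneg (abs_nonneg e) two_ne_zero).1 (by rwa [sq_abs])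

/-- The elements of `Γ` fixing a cusp preserve the heights seen from that cusp. -/
lemma Decoration.height_smul_of_fixed (D : Decoration Γ) {c : OnePoint ℝ} (hc : IsCuspOf Γ c)
    {γ : SL(2, ℝ)} (hγ : γ ∈ Γ) (h : SpecialLinearGroup.mapGL ℝ γ • c = c) (z : ℍ) :
    height c (γ • z) = height c z := by
  obtain ⟨e, he, hv⟩ := D.exists_mulVec_vec hc hγ
  have := vecHeight_mulVec_smul γ (D.vec c) z
  rw [hv, h, vecHeight_smul_vec, ← sq_abs, he, one_pow, div_one, D.vecHeight_vec hc,
    D.vecHeight_vec hc, div_left_inj' (D.level_pos c hc).ne'] at this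
  exact this

/-- The elements of `Γ` fixing a cusp are parabolic or `±1`. -/
lemma Decoration.abs_trace_of_fixed (D : Decoration Γ) {c : OnePoint ℝ} (hc : IsCuspOf Γ c)
    {γ : SL(2, ℝ)} (hγ : γ ∈ Γ) (h : SpecialLinearGroup.mapGL ℝ γ • c = c) :
    |γ.1.trace| = 2 := by
  obtain ⟨e, he, hv⟩ := D.exists_mulVec_vec hc hγ
  rw [h] at hv
  -- The scalar `e = ±1` is an eigenvalue, so the characteristic polynomial gives `e * trace = 2`.
  have hdet : (γ.1 - e • (1 : Matrix (Fin 2) (Fin 2) ℝ)).det = 0 := by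
    rw [← exists_mulVec_eq_zero_iff]
    exact ⟨D.vec c, D.vec_ne_zero hc, by simp [sub_mulVec, smul_mulVec, hv]⟩
  have hd := γ.2
  rw [det_fin_two] at hd hdet
  simp at hdet
  have he2 : e * e = 1 := by rw [← abs_mul_abs_self, he, one_mul]
  rw [trace_fin_two]
  have : e * (γ.1 0 0 + γ.1 1 1) = 2 := by linear_combination hd - hdet + he2
  rw [← abs_two, ← this, abs_mul, he, one_mul]

/-! ### Geodesics of the hyperbolic plane. -/

/-- The vertical geodesic of `ℍ` from `0` to `∞`, parametrized by arc length. -/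
noncomputable def vline (r : ℝ) : ℍ := ⟨⟨0, Real.exp r⟩, Real.exp_pos r⟩

@[simp] lemma vline_re (r : ℝ) : (vline r).re = 0 := rfl

@[simp] lemma vline_im (r : ℝ) : (vline r).im = Real.exp r := rfl

lemma coe_vline (r : ℝ) : (vline r : ℂ) = Real.exp r * Complex.I := by
  apply Complex.ext <;> simp [-Complex.ofReal_exp]

lemma vline_zero : vline 0 = UpperHalfPlane.I :=
  UpperHalfPlane.ext_re_im (by simp) (by simp)

lemma isometry_vline : Isometry vline := isometry_vertical_line 0

lemma vline_injective : Function.Injective vline := isometry_vline.injective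

/-- When `g` maps a point of the vertical line into the vertical line. -/
lemma smul_vline_eq_iff (g : SL(2, ℝ)) (r r' : ℝ) : g • vline r = vline r' ↔
    g.1 0 1 = -(g.1 1 0 * (Real.exp r * Real.exp r')) ∧
      g.1 0 0 * Real.exp r = g.1 1 1 * Real.exp r' := by
  rw [UpperHalfPlane.ext_iff, coe_smul_eq, div_eq_iff (denom_ne_zero' g _), Complex.ext_iff,
    coe_vline, coe_vline]
  simp [-Complex.ofReal_exp]
  constructor
  · rintro ⟨h1, h2⟩
    exact ⟨by linear_combination h1, by linear_combination h2⟩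
  · rintro ⟨h1, h2⟩
    exact ⟨by linear_combination h1, by linear_combination h2⟩

/-- A rotation about `I` moving a given point to the vertical line. -/
lemma exists_rotation (w : ℍ) : ∃ g : SL(2, ℝ), g • UpperHalfPlane.I = UpperHalfPlane.I ∧
    (g • w).re = 0 := by
  -- `F θ` is the real part of the rotated point up to a positive factor. It changes sign between
  -- `0` and `π / 2`, so the intermediate value theorem applies.
  let F : ℝ → ℝ := fun θ =>
    Real.sin θ * Real.cos θ * (1 - w.re ^ 2 - w.im ^ 2) + (Real.cos θ ^ 2 - Real.sin θ ^ 2) * w.re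
  have hF : Continuous F := by fun_prop
  obtain ⟨θ, hθ⟩ : ∃ θ, F θ = 0 := by
    have h0 : F 0 = w.re := by simp [F]
    have h1 : F (Real.pi / 2) = -w.re := by simp [F]
    have := intermediate_value_uIcc (a := 0) (b := Real.pi / 2) hF.continuousOn
    rw [h0, h1] at this
    obtain ⟨θ, -, h⟩ := this (show (0 : ℝ) ∈ _ by
      rw [Set.mem_uIcc]
      rcases le_total 0 w.re with h | h
      · exact Or.inr ⟨by linarith, h⟩
      · exact Or.inl ⟨h, by linarith⟩)
    exact ⟨θ, h⟩
  let g : SL(2, ℝ) := ⟨!![Real.cos θ, Real.sin θ; -Real.sin θ, Real.cos θ], by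
    rw [det_fin_two_of]; nlinarith [Real.sin_sq_add_cos_sq θ]⟩
  refine ⟨g, ?_, ?_⟩
  · rw [← vline_zero, smul_vline_eq_iff]
    simp [g]
  · have e : (g • w).re = ((g • w : ℍ) : ℂ).re := rfl
    rw [e, coe_smul_eq, Complex.div_re, ← add_div]
    have : F θ = 0 := hθ
    refine div_eq_zero_iff.2 (Or.inl ?_)
    simp [g, -Complex.ofReal_sin, -Complex.ofReal_cos]
    linear_combination this

lemma cosh_dist_vline (z : ℍ) (r : ℝ) :
    Real.cosh (dist z (vline r)) * (2 * z.im * Real.exp r) =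
      z.re ^ 2 + z.im ^ 2 + Real.exp r ^ 2 := by
  have hz := z.im_pos
  have hr := Real.exp_pos r
  rw [UpperHalfPlane.cosh_dist, vline_im, add_mul, div_mul_cancel₀ _ (by positivity),
    Complex.dist_eq, ← Complex.normSq_eq_norm_sq, coe_vline, Complex.normSq_apply]
  simp [-Complex.ofReal_exp]
  ring

/-- A point of `ℍ` is determined by its position with respect to two points of a geodesic it
lies on. -/
lemma eq_vline_of_dist {z : ℍ} {r : ℝ} (h0 : dist z (vline 0) = |r|)
    (h1 : dist z (vline 1) = |r - 1|) : z = vline r := by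
  have e0 := cosh_dist_vline z 0
  have e1 := cosh_dist_vline z 1
  rw [h0, Real.cosh_abs, Real.cosh_eq, Real.exp_zero] at e0
  rw [h1, Real.cosh_abs, Real.cosh_eq, neg_sub, Real.exp_sub, Real.exp_sub] at e1
  rw [Real.exp_neg] at e0
  have hr := Real.exp_pos r
  have h1 : 1 < Real.exp 1 := by simp
  set E := Real.exp r
  set e := Real.exp 1
  have him : z.im = E := by
    -- Subtracting the two distance relations eliminates `|z| ^ 2` and leaves a linear equation for
    -- the imaginary part.
    have : (e ^ 2 - 1) * z.im = (e ^ 2 - 1) * E := by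
      field_simp at e0 e1
      nlinarith
    exact mul_left_cancel₀ (by nlinarith) this
  have hre : z.re = 0 := by
    rw [him] at e0
    field_simp at e0
    have : z.re ^ 2 = 0 := by linarith
    simpa using this
  exact UpperHalfPlane.ext_re_im (by simpa using hre) (by simpa using him)

/-- The isometric embeddings of the line into `ℍ` are the translates of the vertical geodesic. -/
lemma exists_eq_smul_vline {f : ℝ → ℍ} (hf : Isometry f) :
    ∃ M : SL(2, ℝ), ∀ r, f r = M • vline r := by
  obtain ⟨M₁, h₁⟩ := MulAction.exists_smul_eq SL(2, ℝ) (f 0) UpperHalfPlane.I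
  obtain ⟨R, hR, hre⟩ := exists_rotation (M₁ • f 1)
  have hd : dist (R • M₁ • f 1) (vline 0) = 1 := by
    rw [vline_zero, ← hR, ← h₁, dist_smul, dist_smul, hf.dist_eq]; simp
  obtain ⟨r, hr⟩ : ∃ r, R • M₁ • f 1 = vline r :=
    ⟨Real.log (R • M₁ • f 1).im, UpperHalfPlane.ext_re_im (by simpa using hre)
      (by simp [Real.exp_log, UpperHalfPlane.im_pos])⟩
  rw [hr, isometry_vline.dist_eq, Real.dist_eq, sub_zero] at hd
  obtain ⟨S, hS0, hS1⟩ : ∃ S : SL(2, ℝ), S • vline 0 = vline 0 ∧ S • vline r = vline 1 := by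
    rcases eq_or_eq_neg_of_abs_eq hd with rfl | rfl
    · exact ⟨1, by simp, by simp⟩
    -- The half-turn about `I` reverses the vertical geodesic.
    · let S : SL(2, ℝ) := ⟨!![0, -1; 1, 0], by simp [det_fin_two_of]⟩
      refine ⟨S, ?_, ?_⟩
      · rw [smul_vline_eq_iff]; simp [S]
      · rw [smul_vline_eq_iff]; simp [S, ← Real.exp_add]
  have k0 : (S * R * M₁) • f 0 = vline 0 := by
    rw [mul_smul, mul_smul, h₁, hR, ← vline_zero, hS0]
  have k1 : (S * R * M₁) • f 1 = vline 1 := by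
    rw [mul_smul, mul_smul, hr, hS1]
  refine ⟨(S * R * M₁)⁻¹, fun r => ?_⟩
  rw [eq_inv_smul_iff]
  apply eq_vline_of_dist
  · rw [← k0, dist_smul, hf.dist_eq, Real.dist_eq, sub_zero]
  · rw [← k1, dist_smul, hf.dist_eq, Real.dist_eq]

lemma vecHeight_vline (v : Fin 2 → ℝ) (r : ℝ) :
    vecHeight v (vline r) = Real.exp r / (v 0 ^ 2 + v 1 ^ 2 * Real.exp r ^ 2) := by
  rw [vecHeight, vline_im, coe_vline, Complex.normSq_apply]
  simp [-Complex.ofReal_exp]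
  ring

lemma tendsto_vecHeight_vline_atTop {p : ℝ} (hp : p ≠ 0) :
    Filter.Tendsto (fun r => vecHeight ![p, 0] (vline r)) Filter.atTop Filter.atTop := by
  have : (fun r => vecHeight ![p, 0] (vline r)) = fun r => Real.exp r / p ^ 2 := by
    ext r; simp [vecHeight_vline]
  rw [this]
  exact Real.tendsto_exp_atTop.atTop_div_const (by positivity)

lemma tendsto_vecHeight_vline_atBot {q : ℝ} (hq : q ≠ 0) :
    Filter.Tendsto (fun r => vecHeight ![0, q] (vline r)) Filter.atBot Filter.atTop := by
  have : (fun r => vecHeight ![0, q] (vline r)) = fun r => Real.exp (-r) / q ^ 2 := by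
    ext r
    rw [vecHeight_vline, Real.exp_neg]
    have := Real.exp_pos r
    simp
    field_simp
  rw [this]
  exact (Real.tendsto_exp_atTop.comp Filter.tendsto_neg_atBot_atTop).atTop_div_const (by positivity)

lemma tendsto_height_vline_atTop :
    Filter.Tendsto (fun r => height OnePoint.infty (vline r)) Filter.atTop Filter.atTop := by
  simp only [height_eq_vecHeight]
  exact tendsto_vecHeight_vline_atTop one_ne_zero

lemma tendsto_height_vline_atBot :
    Filter.Tendsto (fun r => height ((0 : ℝ) : OnePoint ℝ) (vline r)) Filter.atBot
      Filter.atTop := by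
  simp only [height_eq_vecHeight]
  exact tendsto_vecHeight_vline_atBot one_ne_zero

/-! ### Normal form and lambda length of a geodesic arc. -/

/-- The normal form of a geodesic arc between decorated cusps. -/
lemma GeodesicArc.exists_normalForm (D : Decoration Γ) (α : GeodesicArc Γ) :
    ∃ (M : SL(2, ℝ)) (p q : ℝ), p ≠ 0 ∧ q ≠ 0 ∧ (∀ r, α.lift r = M • vline r) ∧
      D.vec α.source = M.1 *ᵥ ![0, q] ∧ D.vec α.target = M.1 *ᵥ ![p, 0] := by
  obtain ⟨M, hM⟩ := exists_eq_smul_vline α.isometry_lift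
  have hs : SpecialLinearGroup.mapGL ℝ M • ((0 : ℝ) : OnePoint ℝ) = α.source := by
    refine eq_of_tendsto_height (l := Filter.atBot) (F := α.lift) one_pos ?_
      (α.tendsto_source.eventually_gt_atTop 1)
    simpa only [hM] using tendsto_height_smul M tendsto_height_vline_atBot
  have ht : SpecialLinearGroup.mapGL ℝ M • (OnePoint.infty : OnePoint ℝ) = α.target := by
    refine eq_of_tendsto_height (l := Filter.atTop) (F := α.lift) one_pos ?_
      (α.tendsto_target.eventually_gt_atTop 1)
    simpa only [hM] using tendsto_height_smul M tendsto_height_vline_atTop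
  obtain ⟨r, hr, hr'⟩ := exists_mulVec_boundaryVec M ((0 : ℝ) : OnePoint ℝ)
  obtain ⟨r₂, hr₂, hr₂'⟩ := exists_mulVec_boundaryVec M OnePoint.infty
  have l1 := Real.sqrt_ne_zero'.2 (D.level_pos _ α.isCusp_source)
  have l2 := Real.sqrt_ne_zero'.2 (D.level_pos _ α.isCusp_target)
  rw [hs] at hr'
  rw [ht] at hr₂'
  refine ⟨M, √(D.level α.target) / r₂, √(D.level α.source) / r, div_ne_zero l2 hr₂,
    div_ne_zero l1 hr, hM, ?_, ?_⟩
  · have : ![0, √(D.level α.source) / r] =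
        (√(D.level α.source) / r) • boundaryVec ((0 : ℝ) : OnePoint ℝ) := by simp
    rw [this, mulVec_smul, hr', smul_smul, div_mul_cancel₀ _ hr]
    rfl
  · have : ![√(D.level α.target) / r₂, 0] =
        (√(D.level α.target) / r₂) • boundaryVec OnePoint.infty := by simp
    rw [this, mulVec_smul, hr₂', smul_smul, div_mul_cancel₀ _ hr₂]
    rfl

/-- The lambda length of a geodesic arc. -/
lemma GeodesicArc.HasLength.exp_half {D : Decoration Γ} {α : GeodesicArc Γ} {a : ℝ}
    (h : α.HasLength D a) :
    Real.exp (a / 2) = |det₂ (D.vec α.source) (D.vec α.target)| := by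
  obtain ⟨M, p, q, hp, hq, hM, hs, ht⟩ := α.exists_normalForm D
  obtain ⟨t₁, t₂, h₁, h₂, rfl⟩ := h
  rw [D.mem_horocycle_iff α.isCusp_source, hs, hM, vecHeight_mulVec_smul, vecHeight_vline] at h₁
  rw [D.mem_horocycle_iff α.isCusp_target, ht, hM, vecHeight_mulVec_smul, vecHeight_vline] at h₂
  rw [hs, ht, det₂_mulVec]
  have e1 := Real.exp_pos t₁
  have e2 := Real.exp_pos t₂
  simp at h₁ h₂
  rw [div_eq_one_iff_eq (by positivity)] at h₁ h₂
  simp only [det₂, cons_val_zero, cons_val_one, zero_mul, zero_sub, abs_neg]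
  rw [← pow_left_inj₀ (Real.exp_pos _).le (abs_nonneg _) two_ne_zero, sq_abs, ← Real.exp_nat_mul]
  have : ((2 : ℕ) : ℝ) * ((t₂ - t₁) / 2) = t₂ - t₁ := by push_cast; ring
  rw [this, Real.exp_sub, h₂, div_eq_iff e1.ne']
  have : q ^ 2 * Real.exp t₁ = 1 := mul_right_cancel₀ e1.ne' (by linear_combination -h₁)
  linear_combination -p ^ 2 * this

/-! ### The universal covering and its lifts. -/

lemma proj_eq_iff {z w : ℍ} : proj Γ z = proj Γ w ↔ ∃ γ ∈ Γ, z = γ • w := by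
  have : proj Γ z = proj Γ w ↔ z ∈ MulAction.orbit Γ w := Quotient.eq''
  rw [this]
  constructor
  · rintro ⟨γ, rfl⟩
    exact ⟨γ, γ.2, rfl⟩
  · rintro ⟨γ, hγ, rfl⟩
    exact ⟨⟨γ, hγ⟩, rfl⟩

lemma proj_smul {γ : SL(2, ℝ)} (hγ : γ ∈ Γ) (z : ℍ) : proj Γ (γ • z) = proj Γ z :=
  proj_eq_iff.2 ⟨γ, hγ, rfl⟩

lemma continuous_proj : Continuous (proj Γ) := continuous_quotient_mk'

lemma neg_one_smul' (z : ℍ) : (-1 : SL(2, ℝ)) • z = z := by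
  apply UpperHalfPlane.ext
  rw [coe_smul_eq]
  simp

/-- Since `-1` acts trivially, the acting group is taken to be the image of `Γ` in the permutations
of `ℍ`, where freeness makes stabilizers trivial. Proper discontinuity supplies the evenly covered
neighbourhoods. -/
lemma isCoveringMap_proj [DiscreteTopology Γ] (hfree : ActsFreely Γ) : IsCoveringMap (proj Γ) := by
  let φ := MulAction.toPermHom Γ ℍ
  have : ContinuousConstSMul φ.range ℍ := by
    refine ⟨?_⟩
    rintro ⟨-, γ, rfl⟩
    exact continuous_const_smul γ
  refine IsQuotientCoveringMap.isCoveringMap (E := ℍ) (f := proj Γ) (G := φ.range) ?_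
  refine { isQuotientMap_quotient_mk' with
    continuous_const_smul := this.continuous_const_smul
    apply_eq_iff_mem_orbit := ?_
    disjoint := ?_ }
  · intro z w
    rw [proj_eq_iff]
    constructor
    · rintro ⟨γ, hγ, rfl⟩
      exact ⟨⟨φ ⟨γ, hγ⟩, ⟨γ, hγ⟩, rfl⟩, rfl⟩
    · rintro ⟨⟨-, γ, rfl⟩, rfl⟩
      exact ⟨γ, γ.2, rfl⟩
  · intro z
    obtain ⟨U, hU, h⟩ := ProperlyDiscontinuousSMul.exists_nhds_image_smul_eq_self Γ z
    refine ⟨U, hU, ?_⟩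
    rintro ⟨-, γ, rfl⟩ hγ
    have hz : γ.1 • z = z := h γ hγ
    ext w
    change ((γ.1 • w : ℍ) : ℂ) = w
    rcases hfree γ γ.2 z hz with h | h
    · rw [h, one_smul]
    · rw [h, neg_one_smul']

section Lifts

variable [DiscreteTopology Γ] (hfree : ActsFreely Γ) {A : Type*} [TopologicalSpace A]
include hfree

lemma exists_lift_homotopy {H : I × A → Surface Γ} (hH : Continuous H) {f : A → ℍ}
    (hf : Continuous f) (h0 : ∀ a, H (0, a) = proj Γ (f a)) :
    ∃ F : I × A → ℍ, Continuous F ∧ (∀ q, proj Γ (F q) = H q) ∧ ∀ a, F (0, a) = f a := by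
  have cov := isCoveringMap_proj hfree
  let F := cov.liftHomotopy ⟨H, hH⟩ ⟨f, hf⟩ h0
  exact ⟨F, F.continuous, fun q => congrFun (cov.liftHomotopy_lifts ⟨H, hH⟩ ⟨f, hf⟩ h0) q,
    cov.liftHomotopy_zero ⟨H, hH⟩ ⟨f, hf⟩ h0⟩

lemma lift_unique [PreconnectedSpace A] {f g : A → ℍ} (hf : Continuous f) (hg : Continuous g)
    (h : ∀ a, proj Γ (f a) = proj Γ (g a)) {γ : SL(2, ℝ)} (hγ : γ ∈ Γ) {a : A}
    (ha : f a = γ • g a) (b : A) : f b = γ • g b := by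
  refine congrFun ((isCoveringMap_proj hfree).eq_of_comp_eq hf (hg.const_smul γ) ?_ a ha) b
  ext a
  simp [h, proj_smul hγ]

lemma exists_deck [PreconnectedSpace A] [Nonempty A] {f g : A → ℍ} (hf : Continuous f)
    (hg : Continuous g) (h : ∀ a, proj Γ (f a) = proj Γ (g a)) :
    ∃ γ ∈ Γ, ∀ a, f a = γ • g a := by
  obtain ⟨a⟩ := ‹Nonempty A›
  obtain ⟨γ, hγ, ha⟩ := proj_eq_iff.1 (h a)
  exact ⟨γ, hγ, lift_unique hfree hf hg h hγ ha⟩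

end Lifts

/-- Paths with coinciding ends in `ℍ` project to null-homotopic loops. -/
lemma nullHomotopic_of_closed {f : I → ℍ} (hf : Continuous f) (h : f 0 = f 1) :
    NullHomotopic fun τ => proj Γ (f τ) := by
  let G : I × I → ℍ := fun q =>
    ⟨(1 - (q.1 : ℝ)) • (f q.2 : ℂ) + (q.1 : ℝ) • Complex.I, by
      have h1 := q.1.2.1
      have h2 := q.1.2.2
      have h3 := (f q.2).im_pos
      simp
      rcases h1.eq_or_lt with h | h
      · rw [← h]; simpa using h3
      · nlinarith [mul_nonneg (sub_nonneg.2 h2) h3.le]⟩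
  refine ⟨proj Γ UpperHalfPlane.I, fun q => proj Γ (G q), continuous_proj.comp ?_, fun τ => ?_,
    fun τ => ?_, fun u => ?_⟩
  · rw [UpperHalfPlane.isEmbedding_coe.continuous_iff]
    change Continuous fun q : I × I => (1 - (q.1 : ℝ)) • (f q.2 : ℂ) + (q.1 : ℝ) • Complex.I
    fun_prop
  · refine congrArg (proj Γ) (UpperHalfPlane.ext ?_)
    simp [G]
  · refine congrArg (proj Γ) (UpperHalfPlane.ext ?_)
    simp [G]
  · simp [G, h]

/-- Null-homotopic loops lift to closed paths. -/
lemma NullHomotopic.closed [DiscreteTopology Γ] (hfree : ActsFreely Γ) {f : I → ℍ}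
    (hf : Continuous f) (h : NullHomotopic fun τ => proj Γ (f τ)) : f 0 = f 1 := by
  obtain ⟨q, H, hH, h0, h1, hcl⟩ := h
  obtain ⟨F, hF, hFH, hF0⟩ := exists_lift_homotopy hfree hH hf h0
  have e1 : F (1, 0) = F (1, 1) :=
    (isCoveringMap_proj hfree).const_of_comp (g := fun τ : I => F (1, τ)) (by fun_prop)
      (fun a b => by rw [hFH, hFH, h1, h1]) 0 1
  -- The two end traces of the lifted homotopy lie over the same path and agree at its final time,
  -- hence also at its initial time.
  have := lift_unique hfree (f := fun u : I => F (u, 0)) (g := fun u : I => F (u, 1))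
    (by fun_prop) (by fun_prop) (fun u => by rw [hFH, hFH, hcl]) (one_mem Γ) (a := 1)
    (by simpa using e1) 0
  simpa [hF0] using this

/-! ### Discreteness: Shimizu's lemma and small horoballs. -/

lemma val_mul (g h : SL(2, ℝ)) : (g * h).1 = g.1 * h.1 := rfl

lemma val_inv (g : SL(2, ℝ)) : (g⁻¹).1 = !![g.1 1 1, -g.1 0 1; -g.1 1 0, g.1 0 0] :=
  adjugate_fin_two _

/-- A discrete group has finitely many elements with bounded entries, in any basis. -/
lemma finite_of_bounded [DiscreteTopology Γ] (M : SL(2, ℝ)) (K : ℝ) :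
    {γ : SL(2, ℝ) | γ ∈ Γ ∧ ∀ i j, |(M⁻¹ * γ * M).1 i j| ≤ K}.Finite := by
  have hc : IsCompact (Set.univ.pi fun _ : Fin 2 => Set.univ.pi fun _ : Fin 2 =>
      Set.Icc (-K) K) :=
    isCompact_univ_pi fun _ => isCompact_univ_pi fun _ => isCompact_Icc
  have hc' := Matrix.SpecialLinearGroup.isClosedEmbedding_val.isCompact_preimage hc
  have hc'' := hc'.image (f := fun g => M * g * M⁻¹) (by fun_prop)
  have hΓ : IsClosed (Γ : Set SL(2, ℝ)) := Subgroup.isClosed_of_discrete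
  have hd : IsDiscrete (Γ : Set SL(2, ℝ)) := ⟨‹_›⟩
  refine ((hc''.inter_right hΓ).finite (hd.mono Set.inter_subset_right)).subset ?_
  rintro γ ⟨hγ, h⟩
  exact ⟨⟨M⁻¹ * γ * M, fun i _ j _ => abs_le.1 (h i j), by simp [mul_assoc]⟩, hγ⟩

lemma conj_translation_apply {g T : SL(2, ℝ)} {w : ℝ} (hT : T.1 = !![1, w; 0, 1]) :
    (g * T * g⁻¹).1 = !![1 - g.1 0 0 * g.1 1 0 * w, g.1 0 0 ^ 2 * w;
      -(g.1 1 0 ^ 2 * w), 1 + g.1 0 0 * g.1 1 0 * w] := by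
  have h := g.2
  rw [det_fin_two] at h
  rw [val_mul, val_mul, val_inv, hT]
  ext i j
  fin_cases i <;> fin_cases j <;> simp [Matrix.mul_apply, Fin.sum_univ_two]
  · linear_combination h
  · ring
  · ring
  · linear_combination h

/-- **Shimizu's lemma**: in a discrete group containing the translation by `w`, an element not
fixing `∞` has lower left entry at least `1 / |w|`. The translation and the entry are read in the
basis `M`. -/
theorem shimizu [DiscreteTopology Γ] (M : SL(2, ℝ)) {P : SL(2, ℝ)} (hP : P ∈ Γ) {w : ℝ}
    (hw : w ≠ 0) (hT : (M⁻¹ * P * M).1 = !![1, w; 0, 1]) {γ : SL(2, ℝ)} (hγ : γ ∈ Γ)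
    (hc : (M⁻¹ * γ * M).1 1 0 ≠ 0) : 1 ≤ |(M⁻¹ * γ * M).1 1 0 * w| := by
  by_contra! hk
  -- If `|c w| < 1` for the lower left entry `c`, iterated conjugation of `P` replaces `c` by `-c ^
  -- 2 * w`, giving infinitely many distinct elements with bounded entries.
  obtain ⟨B, hB0, hBs⟩ : ∃ B : ℕ → SL(2, ℝ), B 0 = γ ∧ ∀ n, B (n + 1) = B n * P * (B n)⁻¹ :=
    ⟨fun n => Nat.rec γ (fun _ b => b * P * b⁻¹) n, rfl, fun _ => rfl⟩
  have hB (n : ℕ) : B n ∈ Γ := by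
    induction n with
    | zero => exact hB0 ▸ hγ
    | succ n ih => exact hBs n ▸ Γ.mul_mem (Γ.mul_mem ih hP) (Γ.inv_mem ih)
  obtain ⟨C, hCB⟩ : ∃ C : ℕ → SL(2, ℝ), ∀ n, C n = M⁻¹ * B n * M := ⟨_, fun _ => rfl⟩
  have hC (n : ℕ) : (C (n + 1)).1 =
      !![1 - (C n).1 0 0 * (C n).1 1 0 * w, (C n).1 0 0 ^ 2 * w;
        -((C n).1 1 0 ^ 2 * w), 1 + (C n).1 0 0 * (C n).1 1 0 * w] := by
    rw [← conj_translation_apply hT, hCB, hCB, hBs]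
    simp only [_root_.mul_inv_rev, inv_inv, mul_assoc, mul_inv_cancel_left]
  rw [← hB0, ← hCB] at hk hc
  set k := |(C 0).1 1 0 * w|
  have hk0 : 0 ≤ k := abs_nonneg _
  -- The choice ensures `1 + a * k ≤ a`, so the bound `a` on the upper left entry survives the
  -- recursion.
  set a := max |(C 0).1 0 0| (1 / (1 - k))
  have ha : 1 ≤ a * (1 - k) := by
    have : 1 / (1 - k) ≤ a := le_max_right _ _
    rwa [div_le_iff₀ (by linarith)] at this
  have ha0 : 0 ≤ a := (abs_nonneg _).trans (le_max_left _ _)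
  have key (n : ℕ) : (C n).1 1 0 ≠ 0 ∧ |(C n).1 1 0 * w| ≤ k ∧ |(C n).1 0 0| ≤ a := by
    induction n with
    | zero => exact ⟨hc, le_rfl, le_max_left _ _⟩
    | succ n ih =>
      obtain ⟨h1, h2, h3⟩ := ih
      rw [hC n]
      refine ⟨by simp [h1, hw], ?_, ?_⟩
      · have : -((C n).1 1 0 ^ 2 * w) * w = -(((C n).1 1 0 * w) * ((C n).1 1 0 * w)) := by ring
        simp only [of_apply, cons_val_one, cons_val_zero, this, abs_neg, abs_mul ((C n).1 1 0 * w)]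
        nlinarith [abs_nonneg ((C n).1 1 0 * w)]
      · simp only [of_apply, cons_val_zero]
        refine (abs_sub _ _).trans ?_
        rw [abs_one, mul_assoc, abs_mul]
        nlinarith [mul_le_mul h3 h2 (abs_nonneg _) ha0]
  have hlt (n : ℕ) : |(C (n + 1)).1 1 0| < |(C n).1 1 0| := by
    obtain ⟨h1, h2, -⟩ := key n
    have : (C (n + 1)).1 1 0 = -((C n).1 1 0 * ((C n).1 1 0 * w)) := by
      rw [hC n]; simp; ring
    rw [this, abs_neg, abs_mul]
    exact mul_lt_of_lt_one_right (abs_pos.2 h1) (h2.trans_lt hk)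
  have hanti : StrictAnti fun n => |(C n).1 1 0| := strictAnti_nat_of_succ_lt hlt
  -- The index is shifted because the recursion bounds all four entries only from the first iterate
  -- on.
  have hinj : Function.Injective fun n => B (n + 1) := by
    intro m n h
    have : |(C (m + 1)).1 1 0| = |(C (n + 1)).1 1 0| := by
      rw [hCB, hCB, show B (m + 1) = B (n + 1) from h]
    exact Nat.succ_injective (hanti.injective this)
  refine Set.infinite_of_injective_forall_mem (s := _) hinj ?_
    (finite_of_bounded (Γ := Γ) M (1 + a * k + a ^ 2 * |w| + |(C 0).1 1 0|))
  intro n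
  refine ⟨hB (n + 1), ?_⟩
  rw [← hCB]
  obtain ⟨h1, h2, h3⟩ := key n
  have h4 : |(C n).1 0 0 * (C n).1 1 0 * w| ≤ a * k := by
    rw [mul_assoc, abs_mul]
    exact mul_le_mul h3 h2 (abs_nonneg _) ha0
  have h5 : 0 ≤ a * k := by positivity
  have h6 : 0 ≤ a ^ 2 * |w| := by positivity
  have h7 := abs_nonneg ((C 0).1 1 0)
  have h8 : |(C (n + 1)).1 1 0| ≤ |(C 0).1 1 0| := hanti.antitone (Nat.zero_le _)
  intro i j
  fin_cases i <;> fin_cases j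
  · rw [hC n]
    refine (abs_sub _ _).trans ?_
    rw [abs_one]
    linarith
  · rw [hC n]
    simp only [of_apply, Fin.zero_eta, Fin.mk_one, cons_val_zero, cons_val_one, abs_mul, abs_pow]
    have : |(C n).1 0 0| ^ 2 * |w| ≤ a ^ 2 * |w| := by gcongr
    linarith
  · exact h8.trans (by linarith)
  · rw [hC n]
    refine (abs_add_le _ _).trans ?_
    rw [abs_one]
    linarith

lemma IsCuspOf.exists_translation {c : OnePoint ℝ} (hc : IsCuspOf Γ c) {M : SL(2, ℝ)}
    (hM : SpecialLinearGroup.mapGL ℝ M • OnePoint.infty = c) :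
    ∃ P ∈ Γ, ∃ w : ℝ, w ≠ 0 ∧ (M⁻¹ * P * M).1 = !![1, w; 0, 1] := by
  obtain ⟨-, ⟨p, hp, rfl⟩, hpar, hfix⟩ := hc
  set q := M⁻¹ * p * M with hq
  have hq0 : q.1 1 0 = 0 := by
    have : SpecialLinearGroup.mapGL ℝ q • (OnePoint.infty : OnePoint ℝ) = OnePoint.infty := by
      rw [hq, map_mul, map_mul, mul_smul, mul_smul, hM, hfix, map_inv, inv_smul_eq_iff, hM]
    simpa using! OnePoint.smul_infty_eq_self_iff.1 this
  have hq1 : q.1.IsParabolic := by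
    have := (isParabolic_conj'_iff (SpecialLinearGroup.mapGL ℝ M)).2 hpar
    rw [← Matrix.coe_units_inv, ← Units.val_mul, ← Units.val_mul, ← map_inv, ← map_mul,
      ← map_mul] at this
    exact this
  rw [isParabolic_iff_of_upperTriangular hq0] at hq1
  have hd := q.2
  rw [det_fin_two, hq0, hq1.1] at hd
  -- Squaring removes the possible sign: in these coordinates `p` has both diagonal entries equal to
  -- the same `±1`.
  refine ⟨p * p, Γ.mul_mem hp hp, 2 * q.1 0 0 * q.1 0 1, ?_, ?_⟩
  · refine mul_ne_zero (mul_ne_zero two_ne_zero fun h => ?_) hq1.2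
    rw [hq1.1] at h
    simp [h] at hd
  · have : M⁻¹ * (p * p) * M = q * q := by rw [hq]; group
    rw [this, val_mul]
    ext i j
    fin_cases i <;> fin_cases j <;> simp [Matrix.mul_apply, Fin.sum_univ_two, hq0, hq1.1]
    · linarith
    · ring
    · linarith

/-- Sufficiently small horoballs at a cusp meet their translates only if these have the same
centre. -/
lemma IsCuspOf.exists_horoball [DiscreteTopology Γ] {c : OnePoint ℝ} (hc : IsCuspOf Γ c) :
    ∃ h : ℝ, 0 < h ∧ ∀ γ ∈ Γ, ∀ z : ℍ, h < height c z → h < height c (γ • z) →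
      SpecialLinearGroup.mapGL ℝ γ • c = c := by
  obtain ⟨M, hM⟩ := OnePoint.exists_mem_SL2 ℝ c
  obtain ⟨P, hP, w, hw, hT⟩ := hc.exists_translation hM
  obtain ⟨r, hr, hheight⟩ := exists_height_smul M OnePoint.infty
  rw [hM] at hheight
  refine ⟨r * |w|, by positivity, fun γ hγ z hz hγz => ?_⟩
  have h1 : |w| < (M⁻¹ • z).im := by
    have := hheight (M⁻¹ • z)
    rw [smul_inv_smul] at this
    rw [this] at hz
    exact lt_of_mul_lt_mul_left hz hr.le
  have h2 : |w| < ((M⁻¹ * γ * M) • M⁻¹ • z).im := by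
    have := hheight (M⁻¹ • γ • z)
    rw [smul_inv_smul] at this
    rw [this] at hγz
    have := lt_of_mul_lt_mul_left hγz hr.le
    rw [smul_smul, mul_assoc, mul_assoc, mul_inv_cancel, mul_one, mul_smul]
    exact this
  have hc0 : (M⁻¹ * γ * M).1 1 0 = 0 := by
    by_contra hne
    have hs := shimizu M hP hw hT hγ hne
    have him := im_smul_mul (M⁻¹ * γ * M) (M⁻¹ • z)
    set x := (M⁻¹ • z).im
    set x' := ((M⁻¹ * γ * M) • M⁻¹ • z).im
    set b := (M⁻¹ * γ * M).1 1 0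
    have hw' := abs_pos.2 hw
    have hx : 0 < x := hw'.trans h1
    have hx' : 0 < x' := hw'.trans h2
    have hn : b ^ 2 * x ^ 2 ≤ Complex.normSq ((b : ℂ) * ↑(M⁻¹ • z) + (M⁻¹ * γ * M).1 1 1) := by
      rw [Complex.normSq_apply]
      have e : (((b : ℂ) * ↑(M⁻¹ • z) + (M⁻¹ * γ * M).1 1 1)).im = b * x := by simp [x]
      rw [e]
      nlinarith [mul_self_nonneg ((b : ℂ) * ↑(M⁻¹ • z) + (M⁻¹ * γ * M).1 1 1).re]
    have h3 : x' * (b ^ 2 * x ^ 2) ≤ x := by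
      exact (mul_le_mul_of_nonneg_left hn hx'.le).trans_eq him
    have h4 : x' * (b ^ 2 * x) ≤ 1 := by
      refine le_of_mul_le_mul_right ?_ hx
      linarith
    have h5 : 1 ≤ b ^ 2 * (|w| * |w|) := by
      have : 1 ≤ |b * w| ^ 2 := one_le_pow₀ hs
      rw [sq_abs, mul_pow] at this
      rwa [abs_mul_abs_self, ← sq]
    have h6 : |w| * |w| < x * x' := mul_lt_mul'' h1 h2 hw'.le hw'.le
    have hb : 0 < b ^ 2 := by positivity
    nlinarith
  have : SpecialLinearGroup.mapGL ℝ (M⁻¹ * γ * M) • (OnePoint.infty : OnePoint ℝ) =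
      OnePoint.infty := by
    rw [OnePoint.smul_infty_eq_self_iff]
    exact hc0
  rw [map_mul, map_mul, map_inv, mul_smul, mul_smul, hM, inv_smul_eq_iff, hM] at this
  exact this

/-- A connected set in the union of the translates of a small horoball lies in one of them. -/
lemma exists_forall_lt_height (D : Decoration Γ) {c : OnePoint ℝ} (hc : IsCuspOf Γ c) {h : ℝ}
    (hh : ∀ γ ∈ Γ, ∀ z : ℍ, h < height c z → h < height c (γ • z) →
      SpecialLinearGroup.mapGL ℝ γ • c = c)
    {A : Type*} [TopologicalSpace A] [PreconnectedSpace A] [Nonempty A] {F : A → ℍ}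
    (hF : Continuous F) (hmem : ∀ a, proj Γ (F a) ∈ proj Γ '' {z | h < height c z}) :
    ∃ γ ∈ Γ, ∀ a, h < height c (γ • F a) := by
  have hmem' (a : A) : ∃ γ ∈ Γ, h < height c (γ • F a) := by
    obtain ⟨z, hz, hza⟩ := hmem a
    obtain ⟨γ, hγ, rfl⟩ := proj_eq_iff.1 hza
    exact ⟨γ, hγ, hz⟩
  obtain ⟨a₀⟩ := ‹Nonempty A›
  obtain ⟨γ₀, hγ₀, h₀⟩ := hmem' a₀
  refine ⟨γ₀, hγ₀, ?_⟩
  have hopen (γ : SL(2, ℝ)) : IsOpen {a | h < height c (γ • F a)} :=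
    isOpen_lt continuous_const ((continuous_height c).comp (hF.const_smul γ))
  -- Translates with the same centre coincide, as the cusp stabilizer preserves heights, and those
  -- with different centres are disjoint. The complement is thus a union of open sets.
  have hcompl : {a | h < height c (γ₀ • F a)}ᶜ = ⋃ γ ∈ {γ | γ ∈ Γ ∧
      SpecialLinearGroup.mapGL ℝ (γ * γ₀⁻¹) • c ≠ c}, {a | h < height c (γ • F a)} := by
    ext a
    simp only [Set.mem_compl_iff, Set.mem_ofPred_eq, Set.mem_iUnion, exists_prop]
    have e (γ : SL(2, ℝ)) : (γ * γ₀⁻¹) • γ₀ • F a = γ • F a := by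
      rw [smul_smul, inv_mul_cancel_right]
    constructor
    · intro ha
      obtain ⟨γ, hγ, hγa⟩ := hmem' a
      refine ⟨γ, ⟨hγ, fun hfix => ha ?_⟩, hγa⟩
      rw [← D.height_smul_of_fixed hc (Γ.mul_mem hγ (Γ.inv_mem hγ₀)) hfix, e]
      exact hγa
    · rintro ⟨γ, ⟨hγ, hne⟩, hγa⟩ ha
      exact hne (hh _ (Γ.mul_mem hγ (Γ.inv_mem hγ₀)) _ ha (by rwa [e]))
  have hclopen : IsClopen {a | h < height c (γ₀ • F a)} := by
    refine ⟨⟨?_⟩, hopen γ₀⟩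
    rw [hcompl]
    exact isOpen_biUnion fun γ _ => hopen γ
  have := hclopen.eq_univ ⟨a₀, h₀⟩
  exact fun a => this.ge (Set.mem_univ a)

/-! ### Lengths of arcs and loops read off lifts. -/

lemma image_mem_punctureFilter (c : OnePoint ℝ) (h : ℝ) :
    proj Γ '' {z | h < height c z} ∈ punctureFilter Γ c :=
  Filter.image_mem_map (Filter.preimage_mem_comap (Filter.Ioi_mem_atTop h))

/-- A homotopy whose ends stay at a puncture lifts to one whose ends stay at a cusp. -/
lemma cusp_eq_of_tendsto [DiscreteTopology Γ] (D : Decoration Γ) {c : OnePoint ℝ}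
    (hc : IsCuspOf Γ c) {l : Filter ℝ} [l.NeBot]
    (hl : ∀ U ∈ l, ∃ S ∈ l, S ⊆ U ∧ IsPreconnected S) {F : I × ℝ → ℍ} (hF : Continuous F)
    (hlim : Filter.Tendsto (fun q => proj Γ (F q)) ((⊤ : Filter I) ×ˢ l) (punctureFilter Γ c))
    {c₀ c₁ : OnePoint ℝ} (h₀ : Filter.Tendsto (fun t => height c₀ (F (0, t))) l Filter.atTop)
    (h₁ : Filter.Tendsto (fun t => height c₁ (F (1, t))) l Filter.atTop) : c₀ = c₁ := by
  obtain ⟨h, hpos, hh⟩ := hc.exists_horoball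
  have hev := hlim (image_mem_punctureFilter c h)
  rw [Filter.mem_map, Filter.mem_prod_iff] at hev
  obtain ⟨V, hV, U, hU, hVU⟩ := hev
  rw [Filter.mem_top] at hV
  obtain ⟨S, hS, hSU, hSc⟩ := hl U hU
  obtain ⟨t, ht⟩ := Filter.nonempty_of_mem hS
  have : PreconnectedSpace S := isPreconnected_iff_preconnectedSpace.1 hSc
  have : Nonempty S := ⟨⟨t, ht⟩⟩
  -- Connectedness of `I × S` puts this part of the lift in a single translate of the horoball,
  -- whose centre must be the limit cusp at both stages of the homotopy.
  obtain ⟨γ, hγ, hγF⟩ := exists_forall_lt_height D hc hh (F := fun q : I × S => F (q.1, q.2))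
    (by fun_prop) fun q => hVU ⟨by rw [hV]; trivial, hSU q.2.2⟩
  have key {c' : OnePoint ℝ} {u : I}
      (hc' : Filter.Tendsto (fun t => height c' (F (u, t))) l Filter.atTop) :
      SpecialLinearGroup.mapGL ℝ γ • c' = c :=
    eq_of_tendsto_height hpos (tendsto_height_smul γ hc')
      (Filter.mem_of_superset hS fun t ht => hγF (u, ⟨t, ht⟩))
  exact MulAction.injective (SpecialLinearGroup.mapGL ℝ γ) ((key h₀).trans (key h₁).symm)

/-- The length of an arc, in terms of the cusps at the ends of a lift. -/
lemma HasArcLength.exp_half [DiscreteTopology Γ] (hfree : ActsFreely Γ) {D : Decoration Γ}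
    {f : ℝ → ℍ} (hf : Continuous f) {c d : OnePoint ℝ}
    (hc : Filter.Tendsto (fun t => height c (f t)) Filter.atBot Filter.atTop)
    (hd : Filter.Tendsto (fun t => height d (f t)) Filter.atTop Filter.atTop) {y : ℝ}
    (h : HasArcLength Γ D (fun t => proj Γ (f t)) y) :
    Real.exp (y / 2) = |det₂ (D.vec c) (D.vec d)| := by
  obtain ⟨β, ⟨c', d', H, hc', hd', hH, h0, h1, hsrc, htgt⟩, hlen⟩ := h
  obtain ⟨F, hF, hFH, hF0⟩ := exists_lift_homotopy hfree hH hf h0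
  obtain ⟨δ, hδ, hFδ⟩ := exists_deck hfree (f := fun t => F (1, t)) (g := β.lift) (by fun_prop)
    β.isometry_lift.continuous fun t => by rw [hFH, h1]; rfl
  rw [← funext hFH] at hsrc htgt
  have e1 : c = SpecialLinearGroup.mapGL ℝ δ • β.source := by
    refine cusp_eq_of_tendsto D hc' (fun U hU => ?_) hF hsrc (by simpa only [hF0] using hc)
      (by simpa only [hFδ] using tendsto_height_smul δ β.tendsto_source)
    obtain ⟨t, ht⟩ := Filter.mem_atBot_sets.1 hU
    exact ⟨Set.Iic t, Filter.Iic_mem_atBot t, ht, isPreconnected_Iic⟩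
  have e2 : d = SpecialLinearGroup.mapGL ℝ δ • β.target := by
    refine cusp_eq_of_tendsto D hd' (fun U hU => ?_) hF htgt (by simpa only [hF0] using hd)
      (by simpa only [hFδ] using tendsto_height_smul δ β.tendsto_target)
    obtain ⟨t, ht⟩ := Filter.mem_atTop_sets.1 hU
    exact ⟨Set.Ici t, Filter.Ici_mem_atTop t, ht, isPreconnected_Ici⟩
  obtain ⟨ε₁, hε₁, hv₁⟩ := D.exists_mulVec_vec β.isCusp_source hδ
  obtain ⟨ε₂, hε₂, hv₂⟩ := D.exists_mulVec_vec β.isCusp_target hδ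
  rw [hlen.exp_half, ← det₂_mulVec δ, hv₁, hv₂, ← e1, ← e2, det₂_smul_left, det₂_smul_right,
    abs_mul, abs_mul, hε₁, hε₂, one_mul, one_mul]

lemma trace_conj (M γ : SL(2, ℝ)) : (M⁻¹ * γ * M).1.trace = γ.1.trace := by
  rw [val_mul, trace_mul_comm, ← val_mul]
  exact congrArg (fun g : SL(2, ℝ) => g.1.trace) (mul_inv_cancel_left M γ)

lemma trace_inv (γ : SL(2, ℝ)) : (γ⁻¹).1.trace = γ.1.trace := by
  rw [val_inv, trace_fin_two_of, trace_fin_two, add_comm]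

/-- The trace of a translation along a geodesic. -/
lemma abs_trace_of_translation {N : SL(2, ℝ)} {x : ℝ} (h : ∀ r, N • vline r = vline (r + x)) :
    |N.1.trace| = 2 * Real.cosh (x / 2) := by
  obtain ⟨h1, h2⟩ := (smul_vline_eq_iff N 0 _).1 (h 0)
  obtain ⟨h3, -⟩ := (smul_vline_eq_iff N 1 _).1 (h 1)
  have hd := N.2
  rw [det_fin_two] at hd
  rw [Real.exp_zero, zero_add] at h1 h2
  rw [Real.exp_add] at h3
  have hx := Real.exp_pos x
  have he : 1 < Real.exp 1 := by simp
  -- Comparing the images of two points of the line kills the lower left entry.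
  have hc : N.1 1 0 = 0 := by
    have : N.1 1 0 * (Real.exp x * (Real.exp 1 ^ 2 - 1)) = 0 := by linear_combination h3 - h1
    exact (mul_eq_zero.1 this).resolve_right (mul_pos hx (by nlinarith)).ne'
  rw [hc, mul_zero, sub_zero] at hd
  have hcosh : (2 * Real.cosh (x / 2)) ^ 2 = Real.exp x + Real.exp (-x) + 2 := by
    have e1 : Real.exp x = Real.exp (x / 2) ^ 2 := by rw [← Real.exp_nat_mul]; congr 1; ring
    have e2 : Real.exp (x / 2) ≠ 0 := (Real.exp_pos _).ne'
    rw [Real.cosh_eq, Real.exp_neg, Real.exp_neg, e1]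
    field_simp
    ring
  rw [← pow_left_inj₀ (abs_nonneg _) (by positivity) two_ne_zero, sq_abs, hcosh, trace_fin_two,
    Real.exp_neg]
  have ha : N.1 0 0 ^ 2 = Real.exp x := by linear_combination N.1 0 0 * h2 + Real.exp x * hd
  have hdd : N.1 1 1 ^ 2 = (Real.exp x)⁻¹ := by
    refine eq_inv_of_mul_eq_one_left ?_
    linear_combination hd - N.1 1 1 * h2
  linear_combination ha + hdd + 2 * hd

/-- The length of a loop, in terms of the deck transformation given by a lift. -/
lemma HasLoopLength.abs_trace [DiscreteTopology Γ] (hfree : ActsFreely Γ) (D : Decoration Γ)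
    {f : I → ℍ} (hf : Continuous f) {γ : SL(2, ℝ)} (hγ : γ ∈ Γ) (hfγ : f 1 = γ • f 0) {x : ℝ}
    (h : HasLoopLength Γ (fun τ => proj Γ (f τ)) x) :
    |γ.1.trace| = 2 * Real.cosh (x / 2) := by
  -- A free homotopy transports the deck transformation `γ` joining the ends of the lift.
  have key {f' : I → Surface Γ} (hff' : FreelyHomotopic (fun τ => proj Γ (f τ)) f') :
      ∃ F : I → ℍ, Continuous F ∧ (∀ τ, proj Γ (F τ) = f' τ) ∧ F 1 = γ • F 0 := by
    obtain ⟨H, hH, h0, h1, hcl⟩ := hff'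
    obtain ⟨F, hF, hFH, hF0⟩ := exists_lift_homotopy hfree hH hf h0
    refine ⟨fun τ => F (1, τ), by fun_prop, fun τ => by rw [hFH, h1], ?_⟩
    exact lift_unique hfree (f := fun u : I => F (u, 1)) (g := fun u : I => F (u, 0))
      (by fun_prop) (by fun_prop) (fun u => by rw [hFH, hFH, hcl]) hγ (a := 0)
      (by simpa only [hF0] using hfγ) 1
  rcases h with ⟨-, g, hg, hper, hfg⟩ | ⟨⟨-, c, hc, hU⟩, rfl⟩
  · obtain ⟨F, hF, hFg, hFγ⟩ := key hfg
    have hgc := hg.continuous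
    obtain ⟨M, hM⟩ := exists_eq_smul_vline hg
    obtain ⟨ε, hε, hεg⟩ := exists_deck hfree (f := fun r => g (r + x)) (g := g) (by fun_prop)
      hgc hper
    obtain ⟨δ, hδ, hδg⟩ := exists_deck hfree (f := F) (g := fun τ : I => g (x * τ)) hF
      (by fun_prop) hFg
    -- The translation `ε` and the conjugate of `γ` agree at a point, so by freeness they agree up
    -- to sign.
    have hfix : (ε⁻¹ * (δ⁻¹ * γ * δ)) • g 0 = g 0 := by
      have e0 := hδg 0
      have e1 := hδg 1
      have e2 := hεg 0
      simp only [Set.Icc.coe_zero, mul_zero, Set.Icc.coe_one, mul_one, zero_add] at e0 e1 e2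
      rw [mul_smul, mul_smul, mul_smul, ← e0, ← hFγ, e1, inv_smul_smul, e2, inv_smul_smul]
    have htr : |γ.1.trace| = |ε.1.trace| := by
      rw [← trace_conj δ γ]
      rcases hfree _ (Γ.mul_mem (Γ.inv_mem hε)
        (Γ.mul_mem (Γ.mul_mem (Γ.inv_mem hδ) hγ) hδ)) _ hfix with h | h
      · rw [← inv_mul_eq_one.1 h]
      · rw [inv_mul_eq_iff_eq_mul.1 h, val_mul]
        simp
    rw [htr, ← trace_conj M]
    refine abs_trace_of_translation fun r => ?_
    rw [mul_smul, mul_smul, ← hM, ← hεg, hM, inv_smul_smul]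
  · obtain ⟨h, hpos, hh⟩ := hc.exists_horoball
    obtain ⟨f', hf'U, hff'⟩ := hU _ (image_mem_punctureFilter c h)
    obtain ⟨F, hF, hFf', hFγ⟩ := key hff'
    obtain ⟨η, hη, hηF⟩ := exists_forall_lt_height D hc hh hF fun τ => by
      rw [hFf']; exact hf'U τ
    have hmem := Γ.mul_mem (Γ.mul_mem hη hγ) (Γ.inv_mem hη)
    -- The conjugate of `γ` by `η` carries a point of the small horoball into that horoball, so it
    -- fixes the cusp and has trace `±2`.
    have hfix := hh _ hmem (η • F 0) (hηF 0) (by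
      rw [smul_smul, inv_mul_cancel_right, mul_smul, ← hFγ]
      exact hηF 1)
    have := D.abs_trace_of_fixed hc hmem hfix
    rw [zero_div, Real.cosh_zero, mul_one, ← this]
    simpa using congrArg abs (trace_conj η⁻¹ γ).symm

/-! ### Lifts of the two resolutions. -/

section Resolutions

variable {f : ℝ → ℍ} {s t : ℝ} {γ : SL(2, ℝ)}

/-- A lift of the arc component of the separating resolution. -/
noncomputable def liftRemove (f : ℝ → ℍ) (s t : ℝ) (γ : SL(2, ℝ)) (r : ℝ) : ℍ :=
  if r ≤ s then f r else γ • f (r + (t - s))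

/-- A lift of the non-separating resolution. -/
noncomputable def liftReverse (f : ℝ → ℍ) (s t : ℝ) (γ : SL(2, ℝ)) (r : ℝ) : ℍ :=
  if r ≤ s then f r else if r ≤ t then γ • f (s + t - r) else (γ * γ) • f r

lemma continuous_liftRemove (hf : Continuous f) (h : f s = γ • f t) :
    Continuous (liftRemove f s t γ) := by
  refine Continuous.if_le hf (by fun_prop) continuous_id continuous_const ?_
  rintro r rfl
  rw [h]; congr 2; ring

lemma continuous_liftReverse (hst : s < t) (hf : Continuous f) (h : f s = γ • f t) :
    Continuous (liftReverse f s t γ) := by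
  refine Continuous.if_le hf (Continuous.if_le ?_ ?_ continuous_id continuous_const ?_)
    continuous_id continuous_const ?_
  · fun_prop
  · fun_prop
  · rintro r rfl
    rw [mul_smul, ← h]; congr 2; ring
  · rintro r rfl
    rw [if_pos hst.le, h]; congr 2; ring

lemma removeLoop_proj (hγ : γ ∈ Γ) :
    removeLoop (fun r => proj Γ (f r)) s t = fun r => proj Γ (liftRemove f s t γ r) := by
  ext r
  rw [removeLoop, liftRemove]
  split_ifs
  · rfl
  · rw [proj_smul hγ]

lemma reverseLoop_proj (hγ : γ ∈ Γ) (h : f s = γ • f t) :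
    reverseLoop (fun r => proj Γ (f r)) s t = fun r => proj Γ (liftReverse f s t γ r) := by
  ext r
  rw [reverseLoop, liftReverse]
  split_ifs with h1 h2 h3 h4 h5
  · have : r = s := le_antisymm h2 h1.1
    rw [this, h, proj_smul hγ]; congr 2; ring
  · rw [proj_smul hγ]
  · exact absurd h1.2 h3
  · rfl
  · exact absurd ⟨(not_le.1 h4).le, h5⟩ h1
  · rw [proj_smul (Γ.mul_mem hγ hγ)]

lemma tendsto_liftRemove_atBot {c : OnePoint ℝ}
    (h : Filter.Tendsto (fun r => height c (f r)) Filter.atBot Filter.atTop) :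
    Filter.Tendsto (fun r => height c (liftRemove f s t γ r)) Filter.atBot Filter.atTop := by
  refine h.congr' ?_
  filter_upwards [Filter.eventually_le_atBot s] with r hr
  rw [liftRemove, if_pos hr]

lemma tendsto_liftReverse_atBot {c : OnePoint ℝ}
    (h : Filter.Tendsto (fun r => height c (f r)) Filter.atBot Filter.atTop) :
    Filter.Tendsto (fun r => height c (liftReverse f s t γ r)) Filter.atBot Filter.atTop := by
  refine h.congr' ?_
  filter_upwards [Filter.eventually_le_atBot s] with r hr
  rw [liftReverse, if_pos hr]

lemma tendsto_liftRemove_atTop {c : OnePoint ℝ}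
    (h : Filter.Tendsto (fun r => height c (f r)) Filter.atTop Filter.atTop) :
    Filter.Tendsto (fun r => height (SpecialLinearGroup.mapGL ℝ γ • c) (liftRemove f s t γ r))
      Filter.atTop Filter.atTop := by
  refine (tendsto_height_smul γ
    (h.comp (Filter.tendsto_atTop_add_const_right _ (t - s) Filter.tendsto_id))).congr' ?_
  filter_upwards [Filter.eventually_gt_atTop s] with r hr
  rw [liftRemove, if_neg (not_le.2 hr)]
  rfl

lemma tendsto_liftReverse_atTop (hst : s < t) {c : OnePoint ℝ}
    (h : Filter.Tendsto (fun r => height c (f r)) Filter.atTop Filter.atTop) :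
    Filter.Tendsto
      (fun r => height (SpecialLinearGroup.mapGL ℝ (γ * γ) • c) (liftReverse f s t γ r))
      Filter.atTop Filter.atTop := by
  refine (tendsto_height_smul (γ * γ) h).congr' ?_
  filter_upwards [Filter.eventually_gt_atTop t] with r hr
  rw [liftReverse, if_neg (not_le.2 (hst.trans hr)), if_neg (not_le.2 hr)]

end Resolutions

/-! ### Curls and self-intersections of lifts. -/

/-- The curls of an arc are the self-intersections of a lift. -/
lemma isCurl_proj_iff [DiscreteTopology Γ] (hfree : ActsFreely Γ) {f : ℝ → ℍ} (hf : Continuous f)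
    {s t : ℝ} : IsCurl (fun r => proj Γ (f r)) s t ↔ s < t ∧ f s = f t := by
  constructor
  · rintro ⟨hst, -, h⟩
    refine ⟨hst, ?_⟩
    have := NullHomotopic.closed hfree (f := fun τ : I => f (s + τ * (t - s))) (by fun_prop) h
    simpa using this
  · rintro ⟨hst, h⟩
    refine ⟨hst, congrArg (proj Γ) h, ?_⟩
    exact nullHomotopic_of_closed (f := fun τ : I => f (s + τ * (t - s))) (by fun_prop)
      (by simpa using h)

/-- A positive supremum requires a nonempty chain of removals, whose first step is a curl of `f`
itself. -/
lemma exists_isCurl_of_curlingNumber {X : Type*} [TopologicalSpace X] {f : ℝ → X}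
    (h : curlingNumber f ≠ 0) : ∃ s t, IsCurl f s t := by
  by_contra! hno
  refine h (le_antisymm (iSup₂_le fun n hn => ?_) zero_le)
  cases hn with
  | zero => simp
  | succ n _ s t hc _ => exact absurd hc (hno s t)

lemma curlingNumber_ne_zero {X : Type*} [TopologicalSpace X] {f : ℝ → X} {s t : ℝ}
    (h : IsCurl f s t) : curlingNumber f ≠ 0 := by
  have h1 : CarriesRemovals 1 f := .succ 0 f s t h (.zero _)
  have : ((1 : ℕ) : ℕ∞) ≤ curlingNumber f :=
    le_iSup₂ (f := fun (n : ℕ) (_ : n ∈ {n : ℕ | CarriesRemovals n f}) => (n : ℕ∞)) 1 h1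
  intro h0
  simp [h0] at this

/-! ### Crossings of the vertical geodesic with its images. -/

section Crossing

variable {N : SL(2, ℝ)} {s t : ℝ}

/-- The images of the vertical geodesic under `N` and the vertical geodesic cross only once. -/
lemma crossing_unique (hN : N • vline t = vline s) (hA : N.1 0 0 ≠ 0) (hC : N.1 1 0 ≠ 0)
    {q r : ℝ} (h : N • vline q = vline r) : q = t ∧ r = s := by
  obtain ⟨h1, h2⟩ := (smul_vline_eq_iff N t s).1 hN
  obtain ⟨h3, h4⟩ := (smul_vline_eq_iff N q r).1 h
  have hD : N.1 1 1 ≠ 0 := by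
    intro h0
    rw [h0, zero_mul] at h2
    exact mul_ne_zero hA (Real.exp_pos t).ne' h2
  have e1 : Real.exp (t + s) = Real.exp (q + r) := by
    rw [Real.exp_add, Real.exp_add]
    exact mul_left_cancel₀ hC (by linear_combination h1 - h3)
  have e2 : Real.exp (q + s) = Real.exp (t + r) := by
    rw [Real.exp_add, Real.exp_add]
    exact mul_left_cancel₀ (mul_ne_zero hA hD) (by
      linear_combination N.1 1 1 * Real.exp s * h4 - N.1 1 1 * Real.exp r * h2)
  have e1 := Real.exp_injective e1
  have e2 := Real.exp_injective e2
  constructor <;> linarith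

lemma mul_self_apply (N : SL(2, ℝ)) :
    (N * N).1 0 0 = N.1 0 0 ^ 2 + N.1 0 1 * N.1 1 0 ∧
    (N * N).1 0 1 = N.1 0 1 * (N.1 0 0 + N.1 1 1) ∧
    (N * N).1 1 0 = N.1 1 0 * (N.1 0 0 + N.1 1 1) ∧
    (N * N).1 1 1 = N.1 1 1 ^ 2 + N.1 0 1 * N.1 1 0 := by
  rw [val_mul]
  simp only [Matrix.mul_apply, Fin.sum_univ_two]
  refine ⟨?_, ?_, ?_, ?_⟩ <;> ring

/-- By Cayley-Hamilton `N * N = (tr N) N - 1`, and the trace terms cancel because `N 0 0 * exp t = N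
1 1 * exp s`. This comparison of the diagonal entries locates the second crossing. -/
lemma crossing_sub (hN : N • vline t = vline s) :
    (N * N).1 1 1 * Real.exp s - (N * N).1 0 0 * Real.exp t = Real.exp t - Real.exp s := by
  obtain ⟨h1, h2⟩ := (smul_vline_eq_iff N t s).1 hN
  obtain ⟨e1, -, -, e2⟩ := mul_self_apply N
  have hd := N.2
  rw [det_fin_two] at hd
  rw [e1, e2]
  linear_combination (Real.exp t - Real.exp s) * hd - (N.1 0 0 + N.1 1 1) * h2

lemma exists_crossing_mul_self (hst : s < t) (hN : N • vline t = vline s)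
    (hZ : 0 < (N * N).1 0 0) : ∃ r q, r ≤ s ∧ t ≤ q ∧ (N * N) • vline q = vline r := by
  obtain ⟨h1, -⟩ := (smul_vline_eq_iff N t s).1 hN
  obtain ⟨-, e1, e2, -⟩ := mul_self_apply N
  have hsub := crossing_sub hN
  have hlt := Real.exp_lt_exp.2 hst
  have hs := Real.exp_pos s
  have ht := Real.exp_pos t
  set Z := (N * N).1 0 0
  set W := (N * N).1 1 1
  have hW : Z * Real.exp t ≤ W * Real.exp s := by linarith
  -- Moving to `s - log k` and `t + log k` keeps the product of the exponentials, hence the first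
  -- crossing equation; the second one determines `k`. That `k ≥ 1` places the crossing on the outer
  -- rays.
  set k := √(W * Real.exp s / (Z * Real.exp t))
  have hk : 1 ≤ k := by
    rw [Real.one_le_sqrt, one_le_div (by positivity)]
    exact hW
  have hk2 : k ^ 2 * (Z * Real.exp t) = W * Real.exp s := by
    have hpos : 0 < Z * Real.exp t := by positivity
    rw [Real.sq_sqrt (div_nonneg (hpos.le.trans hW) hpos.le), div_mul_cancel₀ _ hpos.ne']
  have hk0 : 0 < k := by linarith
  have hlog := Real.log_nonneg hk
  refine ⟨s - Real.log k, t + Real.log k, by linarith, by linarith, ?_⟩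
  rw [smul_vline_eq_iff, Real.exp_sub, Real.exp_add, Real.exp_log hk0, e1, e2]
  constructor
  · field_simp
    linear_combination (N.1 0 0 + N.1 1 1) * h1
  · field_simp
    linear_combination hk2

lemma not_crossing_mul_self (hst : s < t) (hN : N • vline t = vline s)
    (hZ : (N * N).1 0 0 < 0) {r q : ℝ} (hr : r ≤ s) (hq : t ≤ q) :
    (N * N) • vline q ≠ vline r := by
  intro h
  obtain ⟨-, h1⟩ := (smul_vline_eq_iff _ _ _).1 h
  have hsub := crossing_sub hN
  have hlt := Real.exp_lt_exp.2 hst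
  have hr' := Real.exp_le_exp.2 hr
  have hq' := Real.exp_le_exp.2 hq
  have hr0 := Real.exp_pos r
  have hq0 := Real.exp_pos q
  -- With both diagonal entries negative, `crossing_sub` makes `|Z| exp t > |W| exp s`. Moving
  -- outwards only widens this gap, so the crossing equation fails.
  have hW : (N * N).1 1 1 < 0 := by
    by_contra! hW
    nlinarith [mul_nonneg hW hr0.le, mul_pos_of_neg_of_neg hZ (neg_lt_zero.2 hq0)]
  nlinarith [mul_nonneg (neg_nonneg.2 hZ.le) (sub_nonneg.2 hq'),
    mul_nonneg (neg_nonneg.2 hW.le) (sub_nonneg.2 hr')]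

/-- This is the upper left entry of Cayley-Hamilton. The crossing equation gives the diagonal
entries of `N` compatible signs, so the product of absolute values needs no sign. -/
lemma abs_mul_abs_trace (hN : N • vline t = vline s) :
    |N.1.trace| * |N.1 0 0| = 1 + (N * N).1 0 0 := by
  obtain ⟨-, h2⟩ := (smul_vline_eq_iff N t s).1 hN
  have hd := N.2
  rw [det_fin_two] at hd
  have hs := Real.exp_pos s
  have ht := Real.exp_pos t
  have hAD : 0 ≤ N.1 0 0 * N.1 1 1 := by
    have : N.1 0 0 * N.1 1 1 * Real.exp s = N.1 0 0 ^ 2 * Real.exp t := by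
      linear_combination -N.1 0 0 * h2
    have h0 : 0 ≤ N.1 0 0 * N.1 1 1 * Real.exp s := by rw [this]; positivity
    exact nonneg_of_mul_nonneg_left h0 hs
  rw [(mul_self_apply N).1, ← abs_mul, trace_fin_two, abs_of_nonneg (by nlinarith [sq_nonneg (N.1 0 0)])]
  linear_combination hd

/-- If the second image of the vertical geodesic ends on the side from which it starts, then the
lift of the non-separating resolution is simple. -/
lemma liftReverse_injective (hst : s < t) (hN : N • vline t = vline s) (hA : N.1 0 0 ≠ 0)
    (hC : N.1 1 0 ≠ 0) (hZ : (N * N).1 0 0 < 0) {r₁ r₂ : ℝ} (hr : r₁ < r₂) :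
    liftReverse vline s t N r₁ ≠ liftReverse vline s t N r₂ := by
  intro h
  rw [liftReverse, liftReverse] at h
  -- Each piece is a geodesic segment or ray, hence simple. Consecutive pieces meet only at their
  -- common corner by `crossing_unique`, and the outer rays are disjoint since `(N * N) 0 0 < 0`.
  split_ifs at h with h1 h2 h3 h4 h5 h6 h7
  · exact hr.ne (vline_injective h)
  · have := (crossing_unique hN hA hC h.symm).1
    exact h2 (by linarith)
  · exact not_crossing_mul_self hst hN hZ h1 (not_le.1 h3).le h.symm
  · linarith
  · have := vline_injective (smul_left_cancel _ h)
    linarith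
  · rw [mul_smul] at h
    have := (crossing_unique hN hA hC (smul_left_cancel _ h).symm).1
    linarith
  all_goals first
    | linarith
    | exact hr.ne (vline_injective (smul_left_cancel _ h))

end Crossing

/-! ### Lambda lengths as matrix entries. -/

lemma mulVec_mulVec_conj (M γ : SL(2, ℝ)) (v : Fin 2 → ℝ) :
    γ.1 *ᵥ (M.1 *ᵥ v) = M.1 *ᵥ ((M⁻¹ * γ * M).1 *ᵥ v) := by
  rw [mulVec_mulVec, mulVec_mulVec, ← val_mul, ← val_mul]
  exact congrArg (fun g : SL(2, ℝ) => g.1 *ᵥ v) (by group)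

/-- The lambda length of the arc from the source of a geodesic to a translate of its target. -/
lemma Decoration.abs_det₂_vec_smul (D : Decoration Γ) {c d : OnePoint ℝ} (hd : IsCuspOf Γ d)
    {M : SL(2, ℝ)} {p q : ℝ} (hc' : D.vec c = M.1 *ᵥ ![0, q]) (hd' : D.vec d = M.1 *ᵥ ![p, 0])
    {γ : SL(2, ℝ)} (hγ : γ ∈ Γ) :
    |det₂ (D.vec c) (D.vec (SpecialLinearGroup.mapGL ℝ γ • d))| =
      |p * q| * |(M⁻¹ * γ * M).1 0 0| := by
  obtain ⟨e, he, hv⟩ := D.exists_mulVec_vec hd hγ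
  have h1 : |det₂ (D.vec c) (D.vec (SpecialLinearGroup.mapGL ℝ γ • d))| =
      |det₂ (D.vec c) (γ.1 *ᵥ D.vec d)| := by
    rw [hv, det₂_smul_right, abs_mul, he, one_mul]
  rw [h1, hd', mulVec_mulVec_conj, hc', det₂_mulVec, ← abs_mul, ← abs_neg]
  congr 1
  simp only [det₂, mulVec, dotProduct, Fin.sum_univ_two, cons_val_zero, cons_val_one]
  ring

lemma Decoration.smul_eq_self_of_apply_eq_zero (D : Decoration Γ) {d : OnePoint ℝ}
    (hd : IsCuspOf Γ d) {M : SL(2, ℝ)} {p : ℝ} (hd' : D.vec d = M.1 *ᵥ ![p, 0])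
    {γ : SL(2, ℝ)} (hγ : γ ∈ Γ) (h : (M⁻¹ * γ * M).1 1 0 = 0) :
    SpecialLinearGroup.mapGL ℝ γ • d = d := by
  obtain ⟨e, he, hv⟩ := D.exists_mulVec_vec hd hγ
  have h0 : det₂ (D.vec d) (γ.1 *ᵥ D.vec d) = 0 := by
    rw [hd', mulVec_mulVec_conj, det₂_mulVec]
    simp only [det₂, mulVec, dotProduct, Fin.sum_univ_two, h, cons_val_zero, cons_val_one]
    ring
  have he0 : e ≠ 0 := by
    rintro rfl
    simp at he
  have l1 := Real.sqrt_ne_zero'.2 (D.level_pos _ hd)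
  have l2 := Real.sqrt_ne_zero'.2 (D.level_pos _ (hd.smul hγ))
  rw [hv, det₂_smul_right, Decoration.vec, Decoration.vec, det₂_smul_left, det₂_smul_right] at h0
  refine (eq_of_det₂_boundaryVec ?_).symm
  simpa [he0, l1, l2] using h0

lemma liftReverse_of_le {f : ℝ → ℍ} {s t r : ℝ} {γ : SL(2, ℝ)} (hst : s < t) (h : f s = γ • f t)
    (hr : t ≤ r) : liftReverse f s t γ r = (γ * γ) • f r := by
  rw [liftReverse, if_neg (not_le.2 (hst.trans_le hr))]
  split_ifs with hrt
  · obtain rfl := le_antisymm hr hrt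
    rw [mul_smul, ← h, add_sub_cancel_right]
  · rfl

lemma liftReverse_smul (M g : SL(2, ℝ)) (s t r : ℝ) :
    liftReverse (fun r => M • vline r) s t g r = M • liftReverse vline s t (M⁻¹ * g * M) r := by
  rw [liftReverse, liftReverse]
  split_ifs <;> simp [smul_smul, mul_assoc]

end HyperbolicArc

/-! ### The resolution formulae. -/

open HyperbolicArc
theorem mainTheorem11
    (Γ : Subgroup SL(2, ℝ)) [DiscreteTopology Γ] (hfree : ActsFreely Γ)
    (D : Decoration Γ)
    (α : GeodesicArc Γ) (s t : ℝ) (hst : s < t) (hp : α.curve s = α.curve t)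
    (a x y z : ℝ)
    (ha : α.HasLength D a)
    (hx : HasLoopLength Γ (subloop α.curve s t) x)
    (hy : HasArcLength Γ D (removeLoop α.curve s t) y)
    (hz : HasArcLength Γ D (reverseLoop α.curve s t) z) :
    (curlingNumber (reverseLoop α.curve s t) = 0 →
      Real.exp (a / 2) = 2 * Real.cosh (x / 2) * Real.exp (y / 2) + Real.exp (z / 2)) ∧
    (curlingNumber (reverseLoop α.curve s t) = 1 →
      Real.exp (a / 2) = 2 * Real.cosh (x / 2) * Real.exp (y / 2) - Real.exp (z / 2)) := by
  obtain ⟨g, hg, hst'⟩ := proj_eq_iff.1 hp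
  have hcont := α.isometry_lift.continuous
  obtain ⟨M, p, q, hp0, hq0, hM, hsrc, htgt⟩ := α.exists_normalForm D
  have hcurve : α.curve = fun r => proj Γ (α.lift r) := rfl
  rw [hcurve, removeLoop_proj hg] at hy
  rw [hcurve, reverseLoop_proj hg hst'] at hz ⊢
  have hrev := continuous_liftReverse hst hcont hst'
  set N := M⁻¹ * g * M with hNdef
  have hN : N • vline t = vline s := by
    rw [hNdef, mul_smul, mul_smul, ← hM, ← hst', hM, inv_smul_smul]
  have hNN : M⁻¹ * (g * g) * M = N * N := by rw [hNdef]; group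
  have hL : 0 < |p * q| := abs_pos.2 (mul_ne_zero hp0 hq0)
  have ea : Real.exp (a / 2) = |p * q| := by
    have := D.abs_det₂_vec_smul α.isCusp_target hsrc htgt Γ.one_mem
    rw [map_one, one_smul] at this
    rw [ha.exp_half, this]
    simp
  have ey : Real.exp (y / 2) = |p * q| * |N.1 0 0| :=
    (hy.exp_half hfree (continuous_liftRemove hcont hst')
      (tendsto_liftRemove_atBot α.tendsto_source)
      (tendsto_liftRemove_atTop α.tendsto_target)).trans
      (D.abs_det₂_vec_smul α.isCusp_target hsrc htgt hg)
  have ez : Real.exp (z / 2) = |p * q| * |(N * N).1 0 0| := by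
    rw [← hNN]
    exact (hz.exp_half hfree hrev
      (tendsto_liftReverse_atBot α.tendsto_source)
      (tendsto_liftReverse_atTop hst α.tendsto_target)).trans
      (D.abs_det₂_vec_smul α.isCusp_target hsrc htgt (Γ.mul_mem hg hg))
  have ex : |N.1.trace| = 2 * Real.cosh (x / 2) := by
    -- The loop runs from time `s` to time `t`, so its deck transformation is `g⁻¹`.
    rw [hNdef, trace_conj, ← trace_inv]
    refine HasLoopLength.abs_trace hfree D (f := fun τ : unitInterval => α.lift (s + τ * (t - s)))
      (by fun_prop) (Γ.inv_mem hg) ?_ hx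
    simp [hst']
  have hA : N.1 0 0 ≠ 0 := by
    intro h
    rw [h, abs_zero, mul_zero] at ey
    exact (Real.exp_pos _).ne' ey
  have hZ : (N * N).1 0 0 ≠ 0 := by
    intro h
    rw [h, abs_zero, mul_zero] at ez
    exact (Real.exp_pos _).ne' ez
  -- Otherwise `g` fixes the target cusp and has trace `±2`, so `N` has equal diagonal entries and
  -- the crossing equation forces `s = t`.
  have hC : N.1 1 0 ≠ 0 := by
    intro h
    have htr := D.abs_trace_of_fixed α.isCusp_target hg
      (D.smul_eq_self_of_apply_eq_zero α.isCusp_target htgt hg h)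
    rw [← trace_conj M, ← hNdef, Matrix.trace_fin_two] at htr
    have hd := N.2
    rw [Matrix.det_fin_two, h] at hd
    have hsq : (N.1 0 0 + N.1 1 1) ^ 2 = 4 := by
      rw [← sq_abs, htr]; norm_num
    have hAD : N.1 0 0 = N.1 1 1 := by
      have : (N.1 0 0 - N.1 1 1) ^ 2 = 0 := by linear_combination hsq - 4 * hd
      exact sub_eq_zero.1 (pow_eq_zero_iff two_ne_zero |>.1 this)
    have h2 := ((smul_vline_eq_iff N t s).1 hN).2
    rw [← hAD] at h2
    exact hst.ne' (Real.exp_injective (mul_left_cancel₀ hA h2))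
  have hmain : 2 * Real.cosh (x / 2) * Real.exp (y / 2) = |p * q| * (1 + (N * N).1 0 0) := by
    rw [← ex, ey, ← abs_mul_abs_trace hN]; ring
  have hlift (r : ℝ) : liftReverse α.lift s t g r = M • liftReverse vline s t N r := by
    rw [funext hM, liftReverse_smul]
  rw [hmain, ea, ez]
  constructor
  · intro hcurl
    have hneg : (N * N).1 0 0 < 0 := by
      by_contra! hpos
      -- A positive sign makes the outer rays of the lift cross, which gives a curl.
      obtain ⟨r, r', hr, hr', h⟩ := exists_crossing_mul_self hst hN (hpos.lt_of_ne' hZ)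
      refine curlingNumber_ne_zero ((isCurl_proj_iff hfree hrev (s := r) (t := r')).2
        ⟨hr.trans_lt (hst.trans_le hr'), ?_⟩) hcurl
      rw [hlift, hlift, liftReverse_of_le hst hN.symm hr', h, liftReverse, if_pos hr]
    rw [abs_of_neg hneg]
    ring
  · intro hcurl
    have hpos : 0 < (N * N).1 0 0 := by
      by_contra! hneg
      obtain ⟨r, r', hcurl'⟩ := exists_isCurl_of_curlingNumber (by rw [hcurl]; exact one_ne_zero)
      obtain ⟨hr, h⟩ := (isCurl_proj_iff hfree hrev).1 hcurl'
      rw [hlift, hlift] at h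
      exact liftReverse_injective hst hN hA hC (hneg.lt_of_ne hZ) hr (smul_left_cancel _ h)
    rw [abs_of_pos hpos]
    ring
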